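/- For each $i\ge 1$ fix a primitive complex $i$-th root of unity $\zeta_i$. Let $\lambda$ be a partition of $n\ge 0$ (the empty partition if $n=0$) and let $x\in S_n$ have cycle type $\lambda$, with $a_i$ cycles of length $i$ for each $i \ge 1$. Its centralizer is $Z_x\cong\prod_{i\ge1} G_i\wr S_{a_i}$, where $G_i$ is cyclic of order $i$, generated by a cycle of $x$ of length $i$. Let $\omega^x$ be the linear character of $Z_x$ that sends each cycle of $x$ of length $i$, as a generator of a copy of $G_i$, to $\zeta_i$, and is trivial on each wreathing group $S_{a_i}$. The higher Lie character $\psi^\lambda_{S_n}:=\omega^x\uparrow_{Z_x}^{S_n}$ depends only on $\lambda$; write $\psi^\lambda_{S_n}(\nu)$ for its value, and $\operatorname{sign}(\nu)$ for the sign, at elements of cycle type $\nu\vdash n$. For $\nu\vdash n$ with $b_j$ parts of size $j$ ($j\ge1$), let $|Z_\nu|=\prod_j b_j!\,j^{b_j}$ be the order of the centralizer in $S_n$ of an element of cycle type $\nu$, and put $\mathbf t^{c(\nu)}:=\prod_j t_j^{b_j}$, where $\mathbf t=(t_j)_{j\ge1}$ are indeterminates. For even $n\ge0$ let $EP(n)$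 be the set of partitions of $n$ with even parts only; for odd $n$ let $EP(n)$ be the set of partitions of $n$ all of whose parts are even except for a single part of size $1$. **Theorem.** In the ring $\mathbb C[[\mathbf t]]$ of formal power series, $$\sum_{n\ge 0}\ \sum_{\lambda\in EP(n)}\ \sum_{\nu\vdash n}\operatorname{sign}(\nu)\,\psi^\lambda_{S_n}(\nu)\,\frac{\mathbf t^{c(\nu)}}{|Z_\nu|}\;=\;\prod_{p\ge0}\left(\frac{1+t_{2^p}}{1-t_{2^p}}\right)^{1/2^{p+1}},$$ where the infinite sum and the infinite product converge coefficientwise (each coefficient is eventually constant), and $f^{r}:=\sum_{k\ge0}\binom rk (f-1)^k$ for a power series $f$ with constant term $1$. -/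

import Mathlib

open Equiv

namespace HigherLie

/-! ## The linear character of a centralizer -/

section Centralizer

variable {α : Type*}

/-- A chosen base point of the cycle of `x` through `a` (fixed points are cycles of length one). -/
noncomputable def base (x : Perm α) (a : α) : α :=
  (Quotient.mk (Perm.SameCycle.setoid x) a).out

/-- The position of `a` in its cycle: the least `k` with `x ^ k` mapping the base point to `a`. -/
noncomputable def offset (x : Perm α) (a : α) : ℕ :=
  sInf {k : ℕ | (x ^ k) (base x a) = a}

/-- The linear character `ω^x` on the centralizer of `x`, for a choice `ζ i` of a primitive `i`-th
root of unity for each `i ≥ 1`. An element `z` of the centralizer maps the base point of a cycle `c`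
of length `i` to the point at position `k` of a cycle of the same length; the factor of `c` is
`ζ i ^ k`. Thus a single cycle of `x` of length `i` has the value `ζ i`, and the elements of the
wreathing groups, which map base points to base points, have the value `1`. -/
noncomputable def omega [Fintype α] [DecidableEq α] (ζ : ℕ → ℂ) (x : Perm α)
    (z : Subgroup.centralizer {x}) : ℂ :=
  ∏ a : α with base x a = a,
    ζ (Function.minimalPeriod x a) ^ offset x ((z : Perm α) a)

end Centralizer

/-! ## Induced characters and higher Lie characters -/

/-- The function `χ` on the subgroup `H`, extended to `G` by zero. -/
noncomputable def extendZero {G : Type*} [Group G] (H : Subgroup G) (χ : H → ℂ) (g : G) : ℂ :=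
  open Classical in
  if h : g ∈ H then χ ⟨g, h⟩ else 0

/-- The class function on `G` induced from the class function `χ` on the subgroup `H`. -/
noncomputable def induced {G : Type*} [Group G] [Fintype G] (H : Subgroup G) (χ : H → ℂ)
    (g : G) : ℂ :=
  (Nat.card H : ℂ)⁻¹ * ∑ a : G, extendZero H χ (a⁻¹ * g * a)

/-- The higher Lie character `ψ^x` of the symmetric group on `α`. -/
noncomputable def psiPerm {α : Type*} [Fintype α] [DecidableEq α] (ζ : ℕ → ℂ) (x : Perm α) :
    Perm α → ℂ :=
  induced (Subgroup.centralizer {x}) (omega ζ x)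

/-! ## Independence of the choices -/

section WellDefined

variable {α : Type*}

theorem sameCycle_base (x : Perm α) (a : α) : x.SameCycle (base x a) a :=
  Quotient.exact (s := Perm.SameCycle.setoid x) (Quotient.out_eq _)

theorem base_eq {x : Perm α} {a b : α} (h : x.SameCycle a b) : base x a = base x b := by
  unfold base
  rw [Quotient.sound (s := Perm.SameCycle.setoid x) h]

theorem base_base (x : Perm α) (a : α) : base x (base x a) = base x a :=
  base_eq (sameCycle_base x a)

theorem base_pow (x : Perm α) (k : ℕ) (a : α) : base x ((x ^ k) a) = base x a :=
  base_eq ((Perm.sameCycle_pow_left (f := x)).2 (Perm.SameCycle.refl x a))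

theorem offset_spec [Finite α] (x : Perm α) (a : α) : (x ^ offset x a) (base x a) = a := by
  obtain ⟨k, -, hk⟩ := (sameCycle_base x a).exists_pow_eq'
  exact Nat.sInf_mem (s := {k : ℕ | (x ^ k) (base x a) = a}) ⟨k, hk⟩

theorem commute_pow {x z : Perm α} (h : z * x = x * z) (k : ℕ) (a : α) :
    z ((x ^ k) a) = (x ^ k) (z a) := by
  have : Commute z x := h
  exact congrArg (fun p : Perm α => p a) (this.pow_right k).eq

theorem sameCycle_apply {x z : Perm α} [Finite α] (h : z * x = x * z) {a b : α}
    (hab : x.SameCycle a b) : x.SameCycle (z a) (z b) := by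
  obtain ⟨k, -, rfl⟩ := hab.exists_pow_eq'
  rw [commute_pow h]
  exact (Perm.sameCycle_pow_right (f := x)).2 (Perm.SameCycle.refl x _)

theorem period_conj (y x : Perm α) (a : α) :
    Function.minimalPeriod (y * x * y⁻¹) (y a) = Function.minimalPeriod x a := by
  rw [Function.minimalPeriod_eq_minimalPeriod_iff]
  intro n
  unfold Function.IsPeriodicPt Function.IsFixedPt
  rw [Perm.iterate_eq_pow, Perm.iterate_eq_pow, conj_pow]
  simp

theorem period_apply {x z : Perm α} (h : z * x = x * z) (a : α) :
    Function.minimalPeriod x (z a) = Function.minimalPeriod x a := by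
  have := period_conj z x a
  rwa [h, mul_inv_cancel_right] at this

theorem period_sameCycle [Finite α] {x : Perm α} {a b : α} (hab : x.SameCycle a b) :
    Function.minimalPeriod x a = Function.minimalPeriod x b := by
  obtain ⟨k, -, rfl⟩ := hab.exists_pow_eq'
  exact (period_apply (z := x ^ k) (Commute.pow_self x k).eq a).symm

theorem root_pow_eq [Finite α] {ζ : ℕ → ℂ} (hζ : ∀ i : ℕ, 0 < i → IsPrimitiveRoot (ζ i) i)
    (x : Perm α) (a : α) {k l : ℕ} (h : (x ^ k) a = (x ^ l) a) :
    ζ (Function.minimalPeriod x a) ^ k = ζ (Function.minimalPeriod x a) ^ l := by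
  have hpos : 0 < Function.minimalPeriod x a :=
    Function.minimalPeriod_pos_of_mem_periodicPts (x.injective.mem_periodicPts a)
  have h1 := (hζ _ hpos).pow_eq_one
  refine pow_eq_pow_of_modEq (n := Function.minimalPeriod x a) ?_ h1
  rw [← Perm.iterate_eq_pow, ← Perm.iterate_eq_pow,
    ← Function.iterate_mod_minimalPeriod_eq (n := k),
    ← Function.iterate_mod_minimalPeriod_eq (n := l)] at h
  exact (Function.iterate_eq_iterate_iff_of_lt_minimalPeriod (Nat.mod_lt _ hpos)
    (Nat.mod_lt _ hpos)).1 h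

theorem inv_apply_apply (z : Perm α) (a : α) : z⁻¹ (z a) = a := z.symm_apply_apply a

theorem apply_inv_apply (z : Perm α) (a : α) : z (z⁻¹ a) = a := z.apply_symm_apply a

theorem prod_base_apply [Fintype α] [DecidableEq α] {x z : Perm α} (h : z * x = x * z)
    (f : α → ℂ) :
    ∏ a : α with base x a = a, f (base x (z a)) = ∏ a : α with base x a = a, f a := by
  have h' : z⁻¹ * x = x * z⁻¹ := by
    rw [inv_mul_eq_iff_eq_mul, ← mul_assoc, h, mul_inv_cancel_right]
  refine Finset.prod_nbij' (fun a => base x (z a)) (fun a => base x (z⁻¹ a)) ?_ ?_ ?_ ?_ ?_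
  · intro a _; simp [base_base]
  · intro a _; simp [base_base]
  · intro a ha
    have := base_eq (sameCycle_apply h' (sameCycle_base x (z a)))
    rw [inv_apply_apply] at this
    rw [this]; simpa using ha
  · intro a ha
    have := base_eq (sameCycle_apply h (sameCycle_base x (z⁻¹ a)))
    rw [apply_inv_apply] at this
    rw [this]; simpa using ha
  · intro a _; rfl

theorem centralizer_comm {x : Perm α} (z : Subgroup.centralizer {x}) :
    (z : Perm α) * x = x * (z : Perm α) :=
  (Subgroup.mem_centralizer_singleton_iff.1 z.2)

/-- The character `omega` may be computed from any choice of base points. -/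
theorem omega_eq_prod [Fintype α] [DecidableEq α] {ζ : ℕ → ℂ}
    (hζ : ∀ i : ℕ, 0 < i → IsPrimitiveRoot (ζ i) i) (x : Perm α)
    (z : Subgroup.centralizer {x}) (b : α → α) (hb : ∀ a, x.SameCycle (b a) a) (k : α → ℕ)
    (hk : ∀ a, base x a = a →
      (z : Perm α) (b a) = (x ^ k a) (b (base x ((z : Perm α) a)))) :
    omega ζ x z = ∏ a : α with base x a = a, ζ (Function.minimalPeriod x a) ^ k a := by
  have hz := centralizer_comm z
  have hbb : ∀ a, base x a = a → base x (b a) = a := fun a ha => (base_eq (hb a)).trans ha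
  have hne : ∀ a : α, ζ (Function.minimalPeriod x a) ≠ 0 := fun a =>
    (hζ _ (Function.minimalPeriod_pos_of_mem_periodicPts
      (x.injective.mem_periodicPts a))).ne_zero
      (Function.minimalPeriod_pos_of_mem_periodicPts (x.injective.mem_periodicPts a)).ne'
  have hre := prod_base_apply hz
    (fun a => ζ (Function.minimalPeriod x a) ^ offset x (b a))
  have hP : ∏ a : α with base x a = a, ζ (Function.minimalPeriod x a) ^ offset x (b a) ≠ 0 :=
    Finset.prod_ne_zero_iff.2 fun a _ => pow_ne_zero _ (hne a)
  refine mul_right_cancel₀ hP ?_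
  conv_rhs => rw [← hre]
  unfold omega
  rw [← Finset.prod_mul_distrib, ← Finset.prod_mul_distrib]
  refine Finset.prod_congr rfl fun a ha => ?_
  replace ha : base x a = a := by simpa using ha
  set c := base x ((z : Perm α) a) with hc
  have hcc : base x c = c := base_base _ _
  have hper : Function.minimalPeriod x c = Function.minimalPeriod x a := by
    rw [period_sameCycle (sameCycle_base x _), period_apply hz]
  rw [hper, ← pow_add, ← pow_add, ← hper]
  refine root_pow_eq hζ x c ?_
  have e1 : (x ^ offset x (b a)) a = b a := by
    conv_lhs => rw [← hbb a ha, ]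
    have := offset_spec x (b a)
    rwa [hbb a ha] at this ⊢
  have e2 : (x ^ offset x (b c)) c = b c := by
    have := offset_spec x (b c)
    rwa [hbb c hcc] at this
  have e3 : (x ^ offset x ((z : Perm α) a)) c = (z : Perm α) a := offset_spec x _
  rw [add_comm, pow_add, Perm.mul_apply, e3, pow_add, Perm.mul_apply, e2, ← hk a ha,
    ← commute_pow hz, e1]

/-- `omega` is multiplicative, so it is a linear character of the centralizer. -/
theorem omega_mul [Fintype α] [DecidableEq α] {ζ : ℕ → ℂ}
    (hζ : ∀ i : ℕ, 0 < i → IsPrimitiveRoot (ζ i) i) (x : Perm α)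
    (z w : Subgroup.centralizer {x}) :
    omega ζ x (z * w) = omega ζ x z * omega ζ x w := by
  have hz := centralizer_comm z
  have hw := centralizer_comm w
  have hre := prod_base_apply hw
    (fun a => ζ (Function.minimalPeriod x a) ^ offset x ((z : Perm α) a))
  rw [show omega ζ x z = _ from hre.symm, omega, omega, ← Finset.prod_mul_distrib]
  refine Finset.prod_congr rfl fun a _ => ?_
  set c := base x ((w : Perm α) a) with hc
  have hper : Function.minimalPeriod x c = Function.minimalPeriod x a := by
    rw [period_sameCycle (sameCycle_base x _), period_apply hw]
  have e1 : (x ^ offset x ((w : Perm α) a)) c = (w : Perm α) a := offset_spec x _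
  have e2 := offset_spec x ((z : Perm α) c)
  have e3 := offset_spec x ((z : Perm α) ((w : Perm α) a))
  have e4 : base x ((z : Perm α) ((w : Perm α) a)) = base x ((z : Perm α) c) :=
    base_eq (sameCycle_apply hz (sameCycle_base x _).symm)
  have hper2 : Function.minimalPeriod x (base x ((z : Perm α) c)) =
      Function.minimalPeriod x c := by
    rw [period_sameCycle (sameCycle_base x _), period_apply hz]
  rw [hper, ← pow_add, ← hper, ← hper2, Subgroup.coe_mul, Perm.mul_apply]
  refine root_pow_eq hζ x _ ?_
  rw [e4] at e3
  rw [e3, add_comm, pow_add, Perm.mul_apply, e2, ← commute_pow hz, e1]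

theorem conj_mem {x : Perm α} (y : Perm α) (z : Subgroup.centralizer {x}) :
    y * (z : Perm α) * y⁻¹ ∈ Subgroup.centralizer {y * x * y⁻¹} := by
  rw [Subgroup.mem_centralizer_singleton_iff]
  have := centralizer_comm z
  calc y * (z : Perm α) * y⁻¹ * (y * x * y⁻¹) = y * ((z : Perm α) * x) * y⁻¹ := by group
    _ = y * (x * (z : Perm α)) * y⁻¹ := by rw [this]
    _ = _ := by group

theorem sameCycle_conj' {x y : Perm α} {a b : α} (h : (y * x * y⁻¹).SameCycle a b) :
    x.SameCycle (y⁻¹ a) (y⁻¹ b) :=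
  Perm.sameCycle_conj.1 h

theorem omega_conj [Fintype α] [DecidableEq α] {ζ : ℕ → ℂ}
    (hζ : ∀ i : ℕ, 0 < i → IsPrimitiveRoot (ζ i) i) (x y : Perm α)
    (z : Subgroup.centralizer {x}) :
    omega ζ (y * x * y⁻¹) ⟨y * (z : Perm α) * y⁻¹, conj_mem y z⟩ = omega ζ x z := by
  set x' := y * x * y⁻¹ with hx'
  have hz := centralizer_comm z
  have hb : ∀ a, x.SameCycle (y⁻¹ (base x' (y a))) a := by
    intro a
    have := sameCycle_conj' (sameCycle_base x' (y a))
    simpa using this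
  have hfwd : ∀ {a b : α}, x.SameCycle a b → x'.SameCycle (y a) (y b) := by
    intro a b h
    rw [hx', Perm.sameCycle_conj]
    simpa using h
  rw [omega_eq_prod hζ x z (fun a => y⁻¹ (base x' (y a))) hb
    (fun a => offset x' (y ((z : Perm α) (y⁻¹ (base x' (y a))))))]
  · unfold omega
    refine Finset.prod_nbij' (fun a => base x (y⁻¹ a)) (fun a => base x' (y a)) ?_ ?_ ?_ ?_ ?_
    · intro a _
      exact Finset.mem_filter.2 ⟨Finset.mem_univ _, base_base _ _⟩
    · intro a _
      exact Finset.mem_filter.2 ⟨Finset.mem_univ _, base_base _ _⟩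
    · intro a ha
      have := base_eq (hfwd (sameCycle_base x (y⁻¹ a)))
      rw [apply_inv_apply] at this
      rw [this]; simpa using ha
    · intro a ha
      have := base_eq (hb a)
      rw [this]; simpa using ha
    · intro a ha
      have h1 := base_eq (hfwd (sameCycle_base x (y⁻¹ a)))
      rw [apply_inv_apply] at h1
      have h2 : base x' a = a := by simpa using ha
      rw [h1, h2, ← period_sameCycle (sameCycle_base x (y⁻¹ a)).symm, ← period_conj y x (y⁻¹ a)]
      simp [← hx']
  · intro a _
    set p := (z : Perm α) (y⁻¹ (base x' (y a))) with hp
    have h1 := offset_spec x' (y p)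
    have h2 : x.SameCycle p (base x ((z : Perm α) a)) :=
      (sameCycle_apply hz (hb a)).trans (sameCycle_base x _).symm
    have h3 := base_eq (hfwd h2)
    show p = (x ^ offset x' (y p)) (y⁻¹ (base x' (y (base x ((z : Perm α) a)))))
    rw [← h3]
    apply y.injective
    conv_lhs => rw [← h1]
    conv_lhs => rw [hx', conj_pow, ← hx']
    rfl

theorem induced_conj {G : Type*} [Group G] [Fintype G] (H : Subgroup G) (χ : H → ℂ) (g y : G) :
    induced H χ (y * g * y⁻¹) = induced H χ g := by
  unfold induced
  congr 1
  refine Fintype.sum_equiv (Equiv.mulLeft y⁻¹) _ _ fun a => ?_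
  have : a⁻¹ * (y * g * y⁻¹) * a = (y⁻¹ * a)⁻¹ * g * (y⁻¹ * a) := by group
  rw [this, Equiv.coe_mulLeft]

theorem psiPerm_conj [Fintype α] [DecidableEq α] {ζ : ℕ → ℂ}
    (hζ : ∀ i : ℕ, 0 < i → IsPrimitiveRoot (ζ i) i) (x y g : Perm α) :
    psiPerm ζ (y * x * y⁻¹) g = psiPerm ζ x g := by
  classical
  have hmem : ∀ w : Perm α, w ∈ Subgroup.centralizer {x} ↔
      y * w * y⁻¹ ∈ Subgroup.centralizer {y * x * y⁻¹} := by
    intro w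
    refine ⟨fun h => conj_mem y ⟨w, h⟩, fun h => ?_⟩
    have := conj_mem y⁻¹ ⟨_, h⟩
    simpa [mul_assoc] using this
  unfold psiPerm induced
  congr 1
  · congr 2
    symm
    refine Nat.card_congr ((MulAut.conj y).toEquiv.subtypeEquiv fun w => ?_)
    simpa using hmem w
  · refine Fintype.sum_equiv (Equiv.mulRight y) _ _ fun a => ?_
    have e : a⁻¹ * g * a = y * ((a * y)⁻¹ * g * (a * y)) * y⁻¹ := by group
    rw [Equiv.coe_mulRight]
    unfold extendZero
    by_cases h : (a * y)⁻¹ * g * (a * y) ∈ Subgroup.centralizer {x}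
    · have h' := (hmem _).1 h
      rw [dif_pos h, dif_pos (e ▸ h'), ← omega_conj hζ x y ⟨_, h⟩]
      congr 1
      exact Subtype.ext e
    · rw [dif_neg h, dif_neg fun h' => h ((hmem _).2 (e ▸ h'))]

end WellDefined

/-! ## Higher Lie characters indexed by partitions -/

theorem exists_perm {n : ℕ} (lam : n.Partition) :
    ∃ x : Perm (Fin n), x.partition.parts = lam.parts := by
  have hsum : (lam.parts.filter (2 ≤ ·)).sum + (lam.parts.filter (¬ 2 ≤ ·)).sum = n := by
    rw [← Multiset.sum_add, Multiset.filter_add_not, lam.parts_sum]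
  have hone : lam.parts.filter (¬ 2 ≤ ·) =
      Multiset.replicate (Multiset.card (lam.parts.filter (¬ 2 ≤ ·))) 1 := by
    rw [Multiset.eq_replicate]
    refine ⟨rfl, fun b hb => ?_⟩
    rw [Multiset.mem_filter] at hb
    have := lam.parts_pos hb.1
    omega
  obtain ⟨x, hx⟩ := (Perm.exists_with_cycleType_iff (Fin n)
    (m := lam.parts.filter (2 ≤ ·))).2
      ⟨by rw [Fintype.card_fin]; omega, fun a ha => (Multiset.mem_filter.1 ha).2⟩
  refine ⟨x, ?_⟩
  rw [Perm.parts_partition, ← Perm.sum_cycleType, hx, Fintype.card_fin]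
  conv_rhs => rw [← Multiset.filter_add_not (2 ≤ ·) lam.parts, hone]
  congr 2
  have h1 : (lam.parts.filter (¬ 2 ≤ ·)).sum = Multiset.card (lam.parts.filter (¬ 2 ≤ ·)) := by
    conv_lhs => rw [hone]
    simp
  omega

/-- A permutation of cycle type `lam`. -/
noncomputable def permOf {n : ℕ} (lam : n.Partition) : Perm (Fin n) :=
  (exists_perm lam).choose

theorem permOf_spec {n : ℕ} (lam : n.Partition) :
    (permOf lam).partition.parts = lam.parts :=
  (exists_perm lam).choose_spec

/-- The value `ψ^lam(nu)` of the higher Lie character of `S_n` of type `lam` at the conjugacy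
class of cycle type `nu`. -/
noncomputable def psi {n : ℕ} (ζ : ℕ → ℂ) (lam nu : n.Partition) : ℂ :=
  psiPerm ζ (permOf lam) (permOf nu)

/-- The values `psi` do not depend on the chosen permutations: they are the values at any element
of cycle type `nu` of the higher Lie character of any element of cycle type `lam`. -/
theorem psiPerm_eq_psi {n : ℕ} {ζ : ℕ → ℂ} (hζ : ∀ i : ℕ, 0 < i → IsPrimitiveRoot (ζ i) i)
    (lam nu : n.Partition) (x g : Perm (Fin n)) (hx : x.partition.parts = lam.parts)
    (hg : g.partition.parts = nu.parts) : psiPerm ζ x g = psi ζ lam nu := by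
  have hconj : ∀ {u v : Perm (Fin n)}, u.partition.parts = v.partition.parts →
      ∃ y : Perm (Fin n), y * u * y⁻¹ = v := fun h =>
    isConj_iff.1 (Perm.partition_eq_of_isConj.2 (Nat.Partition.ext h))
  obtain ⟨y, hy⟩ := hconj (hx.trans (permOf_spec lam).symm)
  obtain ⟨w, hw⟩ := hconj (hg.trans (permOf_spec nu).symm)
  rw [psi, ← hy, ← hw, psiPerm_conj hζ]
  exact (induced_conj _ _ _ _).symm

/-- The sign of the permutations of cycle type `nu`. -/
noncomputable def signOf {n : ℕ} (nu : n.Partition) : ℤˣ :=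
  Perm.sign (permOf nu)

/-- The order of the centralizer in `S_n` of a permutation of cycle type `nu`. -/
noncomputable def cardZ {n : ℕ} (nu : n.Partition) : ℕ :=
  Nat.card (Subgroup.centralizer {permOf nu})

/-- For even `n`, the partitions of `n` with even parts only; for odd `n`, the partitions of `n`
all of whose parts are even except for a single part of size `1`. -/
def EP (n : ℕ) : Finset n.Partition :=
  {lam | (Even n ∧ ∀ i ∈ lam.parts, Even i) ∨
    (Odd n ∧ lam.parts.count 1 = 1 ∧ ∀ i ∈ lam.parts, i ≠ 1 → Even i)}

/-! ## Formal power series in the indeterminates `t_j` (`t_0` never occurs) -/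

/-- The topology of formal convergence: every coefficient is eventually constant. -/
@[reducible] def formalTopology : TopologicalSpace (MvPowerSeries ℕ ℂ) :=
  @MvPowerSeries.WithPiTopology.instTopologicalSpace ℕ ℂ ⊥

/-- The formal infinite sum `∑ i, f i` exists and equals `F`. -/
def FormalHasSum {ι : Type*} (f : ι → MvPowerSeries ℕ ℂ) (F : MvPowerSeries ℕ ℂ) : Prop :=
  letI := formalTopology
  HasSum f F

/-- The formal infinite product `∏ i, f i` exists and equals `F`. -/
def FormalHasProd {ι : Type*} (f : ι → MvPowerSeries ℕ ℂ) (F : MvPowerSeries ℕ ℂ) : Prop :=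
  letI := formalTopology
  HasProd f F

/-- The power `f ^ r = ∑ k, (r choose k) (f - 1) ^ k` of a formal power series `f` with
constant term `1`. -/
noncomputable def fpow (f : MvPowerSeries ℕ ℂ) (r : ℂ) : MvPowerSeries ℕ ℂ :=
  PowerSeries.subst (f - 1) (PowerSeries.binomialSeries ℂ r)

/-- `fpow f (1 / m)` is an `m`-th root of `f`. -/
theorem fpow_root (f : MvPowerSeries ℕ ℂ) (hf : MvPowerSeries.constantCoeff f = 1) (m : ℕ)
    (hm : 0 < m) : fpow f (1 / m) ^ m = f := by
  have ha : PowerSeries.HasSubst (f - 1) :=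
    PowerSeries.HasSubst.of_constantCoeff_zero (by simp [hf])
  have key : ∀ (r : ℂ) (k : ℕ), PowerSeries.binomialSeries ℂ r ^ k
      = PowerSeries.binomialSeries ℂ (k * r) := by
    intro r k
    induction k with
    | zero => simp
    | succ k ih => rw [pow_succ, ih, ← PowerSeries.binomialSeries_add]; congr 1; push_cast; ring
  have h1 : ((m : ℂ) * (1 / m)) = ((1 : ℕ) : ℂ) := by
    have : (m : ℂ) ≠ 0 := by exact_mod_cast hm.ne'
    field_simp; simp
  rw [fpow, ← PowerSeries.subst_pow ha, key, h1, PowerSeries.binomialSeries_nat, pow_one,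
    ← PowerSeries.coe_substAlgHom ha, map_add, map_one, PowerSeries.coe_substAlgHom,
    PowerSeries.subst_X ha]
  ring

/-- The monomial `t^{c(nu)} = ∏ j, t_j ^ {b_j}`, with `b_j` the number of parts of size `j` in `nu`,
multiplied by the coefficient `a`. -/
noncomputable def cycleTerm {n : ℕ} (nu : n.Partition) (a : ℂ) : MvPowerSeries ℕ ℂ :=
  MvPowerSeries.monomial (Multiset.toFinsupp nu.parts) a

end HigherLie

namespace HigherLie

/-! ### Cycle lengths as minimal periods, under transport and disjoint union -/

section CyclePeriods

variable {α β : Type*}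

/-! By Frobenius reciprocity and the class equation, the degree `n` part of the left side is `1/n!`
times the sum of `ω^x(z) sign(z) t^{c(z)}` over commuting pairs `(x, z)` in `S_n` with the cycle
type of `x` in `EP(n)` (`sum_EP_eq_epSeries`).

Suppose first that all cycles of `x` are even, and mark a point. Its orbit under the group generated
by `x` and `z` is a discrete torus: `i` columns rotated by `x`, and `k` rows permuted by `z`, glued
with a twist `j` modulo `i`. The weight is multiplicative over orbits, and the torus contributes
`ζ_i^j` times a power of one signed variable. Removing the torus gives `n A_n = ∑ c_N A_{n-N}`
(`natCast_mul_evenSeries`), where `c_N` sums over tori with `N` points and `i` even. As `j` varies,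
`ζ_i^j` runs over all `i`-th roots of unity, so grouping by order leaves sums of primitive roots of
unity (values of the Möbius function), and almost everything cancels: `c_N = 0` for odd `N`, and
`c_N = t_1^N + t_{2^p}^q` for `N = 2^p q` with `q` odd and `p ≥ 1` (`evenTorusSum_even`).

Allowing one fixed point multiplies the generating function, with an auxiliary variable `X` marking
`n`, by `1 + t_1 X`. Its logarithmic derivative cancels `t_1^N` for even `N` and supplies `t_1^N`
for odd `N`. Thus the recursion holds for `EP` with the single monomial `t_{2^p}^q` for every `N =
2^p q` (`natCast_mul_epSeries`).

On the product side, let `E` be the derivation with `E t_j = j t_j`. For `t = t_{2^p}` the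
logarithmic derivative of the `p`-th factor is `t / (1 - t^2)`, the sum of the odd powers of `t`
(`euler_rootFactor`). Since every `N ≥ 1` is uniquely `2^p q` with `q` odd, the two sides obey the
same recursion and agree coefficient by coefficient (`coeff_eq_coeff_prod`). -/

theorem minimalPeriod_permCongr (e : α ≃ β) (x : Perm α) (a : α) :
    Function.minimalPeriod (e.permCongr x) (e a) = Function.minimalPeriod x a := by
  rw [Function.minimalPeriod_eq_minimalPeriod_iff]
  intro n
  unfold Function.IsPeriodicPt Function.IsFixedPt
  rw [Perm.iterate_eq_pow, Perm.iterate_eq_pow,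
    show (e.permCongr x) ^ n = e.permCongr (x ^ n) from (map_pow e.permCongrHom x n).symm]
  simp

theorem permCongr_pow (e : α ≃ β) (x : Perm α) (n : ℕ) :
    (e.permCongr x) ^ n = e.permCongr (x ^ n) := (map_pow e.permCongrHom x n).symm

theorem sumCongr_pow (σ : Perm α) (τ : Perm β) (n : ℕ) :
    Perm.sumCongr σ τ ^ n = Perm.sumCongr (σ ^ n) (τ ^ n) :=
  (map_pow (Perm.sumCongrHom α β) (σ, τ) n).symm

theorem minimalPeriod_sumCongr_inl (σ : Perm α) (τ : Perm β) (a : α) :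
    Function.minimalPeriod (Perm.sumCongr σ τ) (Sum.inl a) = Function.minimalPeriod σ a := by
  rw [Function.minimalPeriod_eq_minimalPeriod_iff]
  intro n
  unfold Function.IsPeriodicPt Function.IsFixedPt
  rw [Perm.iterate_eq_pow, Perm.iterate_eq_pow, sumCongr_pow]
  simp

theorem minimalPeriod_sumCongr_inr (σ : Perm α) (τ : Perm β) (a : β) :
    Function.minimalPeriod (Perm.sumCongr σ τ) (Sum.inr a) = Function.minimalPeriod τ a := by
  rw [Function.minimalPeriod_eq_minimalPeriod_iff]
  intro n
  unfold Function.IsPeriodicPt Function.IsFixedPt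
  rw [Perm.iterate_eq_pow, Perm.iterate_eq_pow, sumCongr_pow]
  simp

theorem sameCycle_iff_exists_nat [Finite α] {x : Perm α} {a b : α} :
    x.SameCycle a b ↔ ∃ k : ℕ, (x ^ k) a = b :=
  ⟨fun h => (h.exists_pow_eq').imp fun _ hk => hk.2, fun ⟨k, hk⟩ => ⟨k, by simpa using hk⟩⟩

theorem minimalPeriod_perm_pos [Finite α] (x : Perm α) (a : α) :
    0 < Function.minimalPeriod x a :=
  Function.minimalPeriod_pos_of_mem_periodicPts (x.injective.mem_periodicPts a)

end CyclePeriods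

/-! ### The character `ω^x` is independent of base points and multiplicative -/

section Character

variable {α β : Type*} [Fintype α] [DecidableEq α] [Fintype β] [DecidableEq β]

/-- The value of `omega`, as a function of two permutations. -/
noncomputable def cycleCharacter (ζ : ℕ → ℂ) (x z : Perm α) : ℂ :=
  ∏ a : α with base x a = a, ζ (Function.minimalPeriod x a) ^ offset x (z a)

/-- Compared with `omega_eq_prod`, the product is indexed by the base points of `b` itself, so the
arbitrary choice `base` disappears from computations. The maps `b` and `base x` match the two
systems of base points. -/
theorem cycleCharacter_eq_prod {ζ : ℕ → ℂ} (hζ : ∀ i : ℕ, 0 < i → IsPrimitiveRoot (ζ i) i)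
    {x z : Perm α} (h : z * x = x * z) (b : α → α) (hb : ∀ a, x.SameCycle (b a) a)
    (hc : ∀ a a', x.SameCycle a a' → b a = b a') (k : α → ℕ)
    (hk : ∀ a, b a = a → z a = (x ^ k a) (b (z a))) :
    cycleCharacter ζ x z = ∏ a : α with b a = a, ζ (Function.minimalPeriod x a) ^ k a := by
  have hbb : ∀ a, b (b a) = b a := fun a => hc _ _ (hb a)
  have h1 := omega_eq_prod hζ x ⟨z, Subgroup.mem_centralizer_singleton_iff.2 h⟩ b hb
    (fun a => k (b a)) (by
      intro a _
      change z (b a) = (x ^ k (b a)) (b (base x (z a)))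
      rw [hk _ (hbb a)]
      congr 1
      exact hc _ _ ((sameCycle_apply h (hb a)).trans (sameCycle_base x _).symm))
  change omega ζ x ⟨z, Subgroup.mem_centralizer_singleton_iff.2 h⟩ = _
  rw [h1]
  refine Finset.prod_nbij' b (base x) ?_ ?_ ?_ ?_ ?_
  · intro a _; simp [hbb]
  · intro a _; simp [base_base]
  · intro a ha
    rw [base_eq (hb a)]; simpa using ha
  · intro a ha
    rw [hc _ _ (sameCycle_base x a)]; simpa using ha
  · intro a _
    rw [period_sameCycle (hb a)]

/-- Transport need not carry the chosen base points of `x` to those chosen for `e.permCongr x`, so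
independence of the choice is needed. -/
theorem cycleCharacter_permCongr {ζ : ℕ → ℂ} (hζ : ∀ i : ℕ, 0 < i → IsPrimitiveRoot (ζ i) i)
    (e : α ≃ β) {x z : Perm α} (h : z * x = x * z) :
    cycleCharacter ζ (e.permCongr x) (e.permCongr z) = cycleCharacter ζ x z := by
  have h' : e.permCongr z * e.permCongr x = e.permCongr x * e.permCongr z := by
    simpa using congrArg e.permCongrHom h
  have hsc : ∀ {a b : α}, x.SameCycle a b → (e.permCongr x).SameCycle (e a) (e b) := by
    intro a b hab
    obtain ⟨k, rfl⟩ := sameCycle_iff_exists_nat.1 hab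
    exact sameCycle_iff_exists_nat.2 ⟨k, by simp [permCongr_pow]⟩
  have hsc' : ∀ {a b : β}, (e.permCongr x).SameCycle a b → x.SameCycle (e.symm a) (e.symm b) := by
    intro a b hab
    obtain ⟨k, rfl⟩ := sameCycle_iff_exists_nat.1 hab
    exact sameCycle_iff_exists_nat.2 ⟨k, by simp [permCongr_pow]⟩
  rw [cycleCharacter_eq_prod hζ h' (fun a => e (base x (e.symm a)))
    (fun a => by simpa using hsc (sameCycle_base x (e.symm a)))
    (fun a a' haa => by rw [base_eq (hsc' haa)])
    (fun a => offset x (z (e.symm a)))]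
  · unfold cycleCharacter
    refine Finset.prod_nbij' e.symm e ?_ ?_ ?_ ?_ ?_
    · intro a ha
      simp only [Finset.mem_filter, Finset.mem_univ, true_and] at ha ⊢
      rw [← ha]; simp [base_base]
    · intro a ha
      simp only [Finset.mem_filter, Finset.mem_univ, true_and] at ha ⊢
      simp [ha]
    · simp
    · simp
    · intro a _
      rw [← minimalPeriod_permCongr e, e.apply_symm_apply]
  · intro a _
    simp [permCongr_pow, offset_spec]

theorem cycleCharacter_sumCongr {ζ : ℕ → ℂ} (hζ : ∀ i : ℕ, 0 < i → IsPrimitiveRoot (ζ i) i)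
    {x z : Perm α} (h : z * x = x * z) {x' z' : Perm β} (h' : z' * x' = x' * z') :
    cycleCharacter ζ (Perm.sumCongr x x') (Perm.sumCongr z z') =
      cycleCharacter ζ x z * cycleCharacter ζ x' z' := by
  have hc : Perm.sumCongr z z' * Perm.sumCongr x x' = Perm.sumCongr x x' * Perm.sumCongr z z' := by
    rw [Perm.sumCongr_mul, Perm.sumCongr_mul, h, h']
  rw [cycleCharacter_eq_prod hζ hc (Sum.map (base x) (base x')) ?_ ?_
    (Sum.elim (fun a => offset x (z a)) (fun a => offset x' (z' a))) ?_]
  · rw [Finset.prod_filter, Fintype.prod_sum_type]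
    unfold cycleCharacter
    rw [Finset.prod_filter, Finset.prod_filter]
    simp [minimalPeriod_sumCongr_inl, minimalPeriod_sumCongr_inr]
  · rintro (a | a)
    · exact sameCycle_iff_exists_nat.2 ⟨offset x a, by simp [sumCongr_pow, offset_spec]⟩
    · exact sameCycle_iff_exists_nat.2 ⟨offset x' a, by simp [sumCongr_pow, offset_spec]⟩
  · rintro a b hab
    obtain ⟨k, rfl⟩ := sameCycle_iff_exists_nat.1 hab
    rcases a with a | a <;> simp [sumCongr_pow, base_pow]
  · rintro (a | a) <;> simp [sumCongr_pow, offset_spec]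

end Character

/-! ### Cycle types, signs and cycle monomials -/

section CycleType

variable {α β : Type*} [Fintype α] [DecidableEq α] [Fintype β] [DecidableEq β]

theorem minimalPeriod_eq_card_support_cycleOf (x : Perm α) {a : α} (ha : x a ≠ a) :
    Function.minimalPeriod x a = (x.cycleOf a).support.card := by
  have hc := Perm.isCycle_cycleOf x ha
  rw [← hc.orderOf]
  refine Nat.dvd_antisymm ?_ ?_
  · rw [← Function.isPeriodicPt_iff_minimalPeriod_dvd]
    unfold Function.IsPeriodicPt Function.IsFixedPt
    rw [Perm.iterate_eq_pow, ← Perm.cycleOf_pow_apply_self, pow_orderOf_eq_one, Perm.one_apply]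
  · have h1 : (x.cycleOf a ^ Function.minimalPeriod x a) a = a := by
      rw [Perm.cycleOf_pow_apply_self, ← Perm.iterate_eq_pow]
      exact Function.iterate_minimalPeriod
    rw [orderOf_dvd_iff_pow_eq_one, hc.pow_eq_one_iff]
    exact ⟨a, by rw [Perm.cycleOf_apply_self]; exact ha, h1⟩

/-- Minimal periods treat fixed points as cycles of length one, whereas `cycleType` omits them. This
is the bridge between the two languages. -/
theorem mem_parts_partition_iff (x : Perm α) (m : ℕ) :
    m ∈ x.partition.parts ↔ ∃ a, Function.minimalPeriod x a = m := by
  rw [Perm.parts_partition, Multiset.mem_add, Multiset.mem_replicate, Perm.cycleType_def]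
  constructor
  · rintro (h | ⟨h, rfl⟩)
    · obtain ⟨c, hc, rfl⟩ := Multiset.mem_map.1 h
      replace hc : c ∈ x.cycleFactorsFinset := hc
      obtain ⟨a, ha⟩ := (Perm.mem_cycleFactorsFinset_iff.1 hc).1.nonempty_support
      refine ⟨a, ?_⟩
      have h2 := Perm.cycle_is_cycleOf ha hc
      rw [minimalPeriod_eq_card_support_cycleOf, ← h2]; rfl
      exact Perm.mem_support.1 (Perm.mem_cycleFactorsFinset_support_le hc ha)
    · have : x.supportᶜ.card ≠ 0 := by rwa [Finset.card_compl]
      obtain ⟨a, ha⟩ := Finset.card_ne_zero.1 this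
      refine ⟨a, Function.minimalPeriod_eq_one_iff_isFixedPt.2 ?_⟩
      exact of_not_not fun h => (Finset.mem_compl.1 ha) (Perm.mem_support.2 h)
  · rintro ⟨a, rfl⟩
    by_cases ha : x a = a
    · right
      refine ⟨?_, Function.minimalPeriod_eq_one_iff_isFixedPt.2 ha⟩
      rw [← Finset.card_compl]
      exact Finset.card_ne_zero.2 ⟨a, by simpa using ha⟩
    · left
      refine Multiset.mem_map.2 ⟨x.cycleOf a, ?_, ?_⟩
      · exact Perm.cycleOf_mem_cycleFactorsFinset_iff.2 (Perm.mem_support.2 ha)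
      · rw [minimalPeriod_eq_card_support_cycleOf x ha]; rfl

theorem count_one_parts_partition (x : Perm α) :
    x.partition.parts.count 1 = (Finset.univ.filter fun a => x a = a).card := by
  rw [Perm.parts_partition, Multiset.count_add, Multiset.count_replicate_self,
    Multiset.count_eq_zero_of_notMem, zero_add, ← Finset.card_compl]
  · congr 1; ext a; simp
  · exact fun h => absurd (Perm.two_le_of_mem_cycleType h) (by norm_num)

theorem parts_partition_permCongr (e : α ≃ β) (x : Perm α) :
    (e.permCongr x).partition.parts = x.partition.parts := by
  -- Extension of domain works along an equivalence with a subtype; the always-true predicate turns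
  -- it into plain transport.
  have h := Perm.cycleType_extendDomain (p := fun _ : β => True)
    (e.trans (Equiv.Set.univ β).symm) (g := x)
  have h2 : x.extendDomain (p := fun _ : β => True) (e.trans (Equiv.Set.univ β).symm) =
      e.permCongr x := by
    ext b
    rw [Perm.extendDomain_apply_subtype _ _ trivial]
    rfl
  rw [h2] at h
  rw [Perm.parts_partition, Perm.parts_partition, ← Perm.sum_cycleType, ← Perm.sum_cycleType, h,
    Fintype.card_congr e]

theorem cycleType_sumCongr (x : Perm α) (y : Perm β) :
    (Perm.sumCongr x y).cycleType = x.cycleType + y.cycleType := by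
  have h1 : (Perm.sumCongr x (1 : Perm β)).cycleType = x.cycleType := by
    rw [← Perm.cycleType_extendDomain (Equiv.ofInjective (Sum.inl : α → α ⊕ β) Sum.inl_injective)
      (g := x)]
    congr 1
    ext (a | a)
    · have := Perm.extendDomain_apply_image x
        (Equiv.ofInjective (Sum.inl : α → α ⊕ β) Sum.inl_injective) a
      rw [Equiv.ofInjective_apply, Equiv.ofInjective_apply] at this
      rw [this]; simp
    · rw [Perm.extendDomain_apply_not_subtype _ _ (by simp)]; simp
  have h2 : (Perm.sumCongr (1 : Perm α) y).cycleType = y.cycleType := by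
    rw [← Perm.cycleType_extendDomain (Equiv.ofInjective (Sum.inr : β → α ⊕ β) Sum.inr_injective)
      (g := y)]
    congr 1
    ext (a | a)
    · rw [Perm.extendDomain_apply_not_subtype _ _ (by simp)]; simp
    · have := Perm.extendDomain_apply_image y
        (Equiv.ofInjective (Sum.inr : β → α ⊕ β) Sum.inr_injective) a
      rw [Equiv.ofInjective_apply, Equiv.ofInjective_apply] at this
      rw [this]; simp
  -- The two factors are disjoint, and each is an extension by the identity.
  have h3 : Perm.sumCongr x y = Perm.sumCongr x 1 * Perm.sumCongr 1 y := by
    rw [Perm.sumCongr_mul, mul_one, one_mul]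
  rw [h3, Perm.Disjoint.cycleType_mul, h1, h2]
  rintro (a | a)
  · right; simp
  · left; simp

theorem parts_partition_sumCongr (x : Perm α) (y : Perm β) :
    (Perm.sumCongr x y).partition.parts = x.partition.parts + y.partition.parts := by
  rw [Perm.parts_partition, Perm.parts_partition, Perm.parts_partition, ← Perm.sum_cycleType,
    ← Perm.sum_cycleType, ← Perm.sum_cycleType, cycleType_sumCongr, Fintype.card_sum,
    Multiset.sum_add]
  have hx := x.sum_cycleType_le
  have hy := y.sum_cycleType_le
  rw [show Fintype.card α + Fintype.card β - (x.cycleType.sum + y.cycleType.sum) =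
    (Fintype.card α - x.cycleType.sum) + (Fintype.card β - y.cycleType.sum) by omega,
    Multiset.replicate_add]
  abel

theorem parts_partition_eq_replicate (x : Perm α) {m : ℕ}
    (h : ∀ a, Function.minimalPeriod x a = m) {c : ℕ} (hm : 0 < m) (hc : Fintype.card α = c * m) :
    x.partition.parts = Multiset.replicate c m := by
  have h1 : x.partition.parts = Multiset.replicate (Multiset.card x.partition.parts) m := by
    rw [Multiset.eq_replicate]
    refine ⟨rfl, fun b hb => ?_⟩
    obtain ⟨a, rfl⟩ := (mem_parts_partition_iff x b).1 hb
    exact h a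
  have h2 := x.partition.parts_sum
  rw [h1, Multiset.sum_replicate, smul_eq_mul] at h2
  replace h2 := h2.trans hc
  rw [h1, Nat.eq_of_mul_eq_mul_right hm h2]

/-- The indeterminate `t_m`, with the sign of an `m`-cycle. -/
noncomputable def signedVar (m : ℕ) : MvPowerSeries ℕ ℂ := -(-1) ^ m * MvPowerSeries.X m

/-- The product of the signed indeterminates over the cycles of `z`. -/
noncomputable def cycleMonomial (z : Perm α) : MvPowerSeries ℕ ℂ :=
  (z.partition.parts.map signedVar).prod

theorem cycleMonomial_permCongr (e : α ≃ β) (z : Perm α) :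
    cycleMonomial (e.permCongr z) = cycleMonomial z := by
  rw [cycleMonomial, parts_partition_permCongr]; rfl

theorem cycleMonomial_sumCongr (z : Perm α) (z' : Perm β) :
    cycleMonomial (Perm.sumCongr z z') = cycleMonomial z * cycleMonomial z' := by
  rw [cycleMonomial, parts_partition_sumCongr, Multiset.map_add, Multiset.prod_add]; rfl

theorem sign_eq_prod_parts (z : Perm α) :
    (Perm.sign z : ℤˣ) = (z.partition.parts.map fun m => -(-1 : ℤˣ) ^ m).prod := by
  rw [Perm.sign_of_cycleType', Perm.parts_partition, Multiset.map_add, Multiset.prod_add,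
    Multiset.map_replicate, Multiset.prod_replicate]
  simp

theorem monomial_toFinsupp (s : Multiset ℕ) (a : ℂ) :
    MvPowerSeries.monomial (Multiset.toFinsupp s) a =
      MvPowerSeries.C a * (s.map fun m => (MvPowerSeries.X m : MvPowerSeries ℕ ℂ)).prod := by
  induction s using Multiset.induction_on generalizing a with
  | empty => simp [MvPowerSeries.monomial_zero_eq_C_apply]
  | cons m s ih =>
    rw [Multiset.map_cons, Multiset.prod_cons, mul_left_comm, ← ih, ← Multiset.singleton_add,
      map_add, Multiset.toFinsupp_singleton, MvPowerSeries.X_def,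
      MvPowerSeries.monomial_mul_monomial, one_mul]

theorem cycleMonomial_eq_monomial (z : Perm α) :
    cycleMonomial z = MvPowerSeries.monomial (Multiset.toFinsupp z.partition.parts)
      ((Perm.sign z : ℤ) : ℂ) := by
  rw [monomial_toFinsupp, sign_eq_prod_parts, cycleMonomial]
  generalize z.partition.parts = s
  induction s using Multiset.induction_on with
  | empty => simp
  | cons m s ih =>
    rw [Multiset.map_cons, Multiset.prod_cons, ih, Multiset.map_cons, Multiset.prod_cons,
      Multiset.map_cons, Multiset.prod_cons, signedVar]
    push_cast
    simp only [map_mul, map_neg, map_pow, map_one]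
    ring

end CycleType

/-! ### The model torus: cycles, weight and character -/

section Torus

/-- The horizontal rotation of a discrete torus with `a + 1` columns and `b + 1` rows. -/
def torusRot (a b : ℕ) : Perm (Fin (a + 1) × Fin (b + 1)) :=
  Equiv.prodCongr (Equiv.addRight 1) (Equiv.refl _)

/-- The vertical rotation of a discrete torus whose top and bottom are glued with a twist `j`. -/
def torusTwist (a b : ℕ) (j : Fin (a + 1)) : Perm (Fin (a + 1) × Fin (b + 1)) :=
  (Equiv.prodCongrLeft fun v => Equiv.addRight (if v = Fin.last b then j else 0)).trans
    (Equiv.prodCongr (Equiv.refl _) (Equiv.addRight 1))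

variable {a b : ℕ} {j : Fin (a + 1)}

@[simp]
theorem torusRot_apply (u : Fin (a + 1)) (v : Fin (b + 1)) : torusRot a b (u, v) = (u + 1, v) := rfl

@[simp]
theorem torusTwist_apply (u : Fin (a + 1)) (v : Fin (b + 1)) :
    torusTwist a b j (u, v) = (u + if v = Fin.last b then j else 0, v + 1) := rfl

theorem torus_comm : torusTwist a b j * torusRot a b = torusRot a b * torusTwist a b j := by
  ext1 ⟨u, v⟩
  simp [add_right_comm]

theorem torusRot_pow_apply (n : ℕ) (u : Fin (a + 1)) (v : Fin (b + 1)) :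
    (torusRot a b ^ n) (u, v) = (u + (Fin.ofNat (a + 1) n), v) := by
  induction n with
  | zero => simp
  | succ n ih =>
    rw [pow_succ', Perm.mul_apply, ih, torusRot_apply, add_assoc]
    congr 2
    ext
    simp [Fin.val_add]

theorem torusRot_pow_val_apply (t u : Fin (a + 1)) (v : Fin (b + 1)) :
    (torusRot a b ^ t.val) (u, v) = (u + t, v) := by
  rw [torusRot_pow_apply]; simp

theorem torusTwist_pow_apply {n : ℕ} (hn : n ≤ b) (u : Fin (a + 1)) :
    (torusTwist a b j ^ n) (u, 0) = (u, ⟨n, Nat.lt_succ_of_le hn⟩) := by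
  induction n with
  | zero => simp
  | succ n ih =>
    rw [pow_succ', Perm.mul_apply, ih (by omega), torusTwist_apply, if_neg]
    · ext
      · simp
      · simp [Fin.val_add, Nat.mod_eq_of_lt (show n + 1 < b + 1 by omega)]
    · intro h
      have := congrArg Fin.val h
      simp at this
      omega

/-- A full vertical turn crosses the glued seam exactly once. -/
theorem torusTwist_pow_height (u : Fin (a + 1)) :
    (torusTwist a b j ^ (b + 1)) (u, 0) = (u + j, 0) := by
  rw [pow_succ', Perm.mul_apply, torusTwist_pow_apply le_rfl, torusTwist_apply]
  rw [if_pos (by ext; simp)]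
  ext <;> simp [Fin.val_add]

theorem torusTwist_pow_height_mul (u : Fin (a + 1)) (n : ℕ) :
    (torusTwist a b j ^ ((b + 1) * n)) (u, 0) = (u + n • j, 0) := by
  induction n with
  | zero => simp
  | succ n ih =>
    rw [mul_add, mul_one, add_comm (_ * n), pow_add, Perm.mul_apply, ih, torusTwist_pow_height, add_assoc,
      succ_nsmul]

theorem torus_eq_pow_pow (u : Fin (a + 1)) (v : Fin (b + 1)) :
    (u, v) = (torusRot a b ^ u.val) ((torusTwist a b j ^ v.val) (0, 0)) := by
  rw [torusTwist_pow_apply (Nat.lt_succ_iff.1 v.2), torusRot_pow_val_apply, zero_add]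

theorem minimalPeriod_torusRot (p : Fin (a + 1) × Fin (b + 1)) :
    Function.minimalPeriod (torusRot a b) p = a + 1 := by
  obtain ⟨u, v⟩ := p
  refine Nat.dvd_antisymm ?_ ?_
  · rw [← Function.isPeriodicPt_iff_minimalPeriod_dvd]
    unfold Function.IsPeriodicPt Function.IsFixedPt
    rw [Perm.iterate_eq_pow, torusRot_pow_apply]
    ext <;> simp
  · have h : (⇑(torusRot a b))^[Function.minimalPeriod (torusRot a b) (u, v)] (u, v) = (u, v) :=
      Function.iterate_minimalPeriod
    rw [Perm.iterate_eq_pow, torusRot_pow_apply, Prod.mk.injEq] at h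
    have h1 := congrArg Fin.val (add_eq_left.1 h.1)
    exact Nat.dvd_of_mod_eq_zero (by simpa using h1)

/-- A path returns to its row only after a multiple of `b + 1` steps, and each turn shifts the
column by `j`. The starting point is irrelevant, because the two commuting permutations act
transitively. -/
theorem minimalPeriod_torusTwist (p : Fin (a + 1) × Fin (b + 1)) :
    Function.minimalPeriod (torusTwist a b j) p = (b + 1) * addOrderOf j := by
  obtain ⟨u, v⟩ := p
  rw [torus_eq_pow_pow (j := j) u v]
  have hr : torusRot a b ^ u.val * torusTwist a b j = torusTwist a b j * torusRot a b ^ u.val :=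
    ((show Commute (torusTwist a b j) (torusRot a b) from torus_comm).pow_right _).eq.symm
  rw [period_apply hr, period_apply (Commute.pow_self _ _).eq]
  refine Nat.dvd_antisymm ?_ ?_
  · rw [← Function.isPeriodicPt_iff_minimalPeriod_dvd]
    unfold Function.IsPeriodicPt Function.IsFixedPt
    rw [Perm.iterate_eq_pow, torusTwist_pow_height_mul, addOrderOf_nsmul_eq_zero, add_zero]
  · have h : (⇑(torusTwist a b j))^[Function.minimalPeriod (torusTwist a b j) (0, 0)] (0, 0) =
      (0, 0) := Function.iterate_minimalPeriod
    rw [Perm.iterate_eq_pow] at h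
    set n := Function.minimalPeriod (torusTwist a b j) (0, 0)
    -- Full turns preserve row `0`, so the final row is the remainder of `n` modulo `b + 1`.
    rw [← Nat.mod_add_div n (b + 1), pow_add, Perm.mul_apply, torusTwist_pow_height_mul,
      torusTwist_pow_apply (Nat.lt_succ_iff.1 (Nat.mod_lt _ (Nat.succ_pos b))), Prod.mk.injEq] at h
    have h2 : n % (b + 1) = 0 := congrArg Fin.val h.2
    rw [← Nat.mod_add_div n (b + 1), h2, zero_add]
    refine Nat.mul_dvd_mul_left _ (addOrderOf_dvd_iff_nsmul_eq_zero.2 ?_)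
    simpa using h.1

theorem cycleMonomial_torusTwist :
    cycleMonomial (torusTwist a b j) =
      signedVar ((b + 1) * addOrderOf j) ^ ((a + 1) / addOrderOf j) := by
  have hd : addOrderOf j ∣ a + 1 := by simpa using addOrderOf_dvd_card (x := j)
  have hpos : 0 < addOrderOf j := addOrderOf_pos j
  rw [cycleMonomial, parts_partition_eq_replicate _ minimalPeriod_torusTwist
    (c := (a + 1) / addOrderOf j) (by positivity), Multiset.map_replicate, Multiset.prod_replicate]
  rw [Fintype.card_prod, Fintype.card_fin, Fintype.card_fin, mul_left_comm, Nat.div_mul_cancel hd,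
    mul_comm]

/-- With column `0` as base points, the vertical rotation maps base points to base points except
across the seam, where it lands at position `j`. -/
theorem cycleCharacter_torus {ζ : ℕ → ℂ} (hζ : ∀ i : ℕ, 0 < i → IsPrimitiveRoot (ζ i) i) :
    cycleCharacter ζ (torusRot a b) (torusTwist a b j) = ζ (a + 1) ^ j.val := by
  rw [cycleCharacter_eq_prod hζ torus_comm (fun p => (0, p.2)) ?_ ?_
    (fun p => if p.2 = Fin.last b then j.val else 0) ?_]
  · rw [Finset.prod_eq_single ((0, Fin.last b) : Fin (a + 1) × Fin (b + 1))]
    · simp [minimalPeriod_torusRot]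
    · rintro ⟨u, v⟩ h1 h2
      have hu : (0 : Fin (a + 1)) = u := by simpa using h1
      rw [if_neg, pow_zero]
      rintro rfl
      exact h2 (by rw [hu])
    · simp
  · rintro ⟨u, v⟩
    exact sameCycle_iff_exists_nat.2 ⟨u.val, by rw [torusRot_pow_val_apply, zero_add]⟩
  · intro p q h
    obtain ⟨k, rfl⟩ := sameCycle_iff_exists_nat.1 h
    rw [torusRot_pow_apply]
  · rintro ⟨u, v⟩ h
    have hu : (0 : Fin (a + 1)) = u := by simpa using h
    subst hu
    simp only [torusTwist_apply]
    split_ifs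
    · rw [torusRot_pow_val_apply]
    · simp

end Torus

/-! ### Orbits of commuting pairs are embedded tori -/

section Embeddings

variable {α : Type*} {a b : ℕ} {j : Fin (a + 1)}

/-- The map `e` is an embedding of the pair `(σ, τ)` into the pair `(x, z)`. -/
def Intertwines {T : Type*} (σ τ : Perm T) (x z : Perm α) (e : T ↪ α) : Prop :=
  (∀ t, x (e t) = e (σ t)) ∧ ∀ t, z (e t) = e (τ t)

theorem pow_apply_embedding {T : Type*} {σ : Perm T} {x : Perm α} {e : T ↪ α}
    (h : ∀ t, x (e t) = e (σ t)) (n : ℕ) (t : T) : (x ^ n) (e t) = e ((σ ^ n) t) := by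
  induction n with
  | zero => rfl
  | succ n ih => rw [pow_succ', Perm.mul_apply, ih, h, pow_succ', Perm.mul_apply]

variable {x z : Perm α} {e : Fin (a + 1) × Fin (b + 1) ↪ α}

theorem Intertwines.apply_eq (h : Intertwines (torusRot a b) (torusTwist a b j) x z e)
    (u : Fin (a + 1)) (v : Fin (b + 1)) : e (u, v) = (x ^ u.val) ((z ^ v.val) (e (0, 0))) := by
  rw [pow_apply_embedding h.2,
    pow_apply_embedding h.1, ← torus_eq_pow_pow]

theorem Intertwines.minimalPeriod (h : Intertwines (torusRot a b) (torusTwist a b j) x z e)  :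
    Function.minimalPeriod x (e (0, 0)) = a + 1 := by
  refine Eq.trans ?_ (minimalPeriod_torusRot ((0, 0) : Fin (a + 1) × Fin (b + 1)))
  rw [Function.minimalPeriod_eq_minimalPeriod_iff]
  intro n
  unfold Function.IsPeriodicPt Function.IsFixedPt
  rw [Perm.iterate_eq_pow, Perm.iterate_eq_pow,
    pow_apply_embedding h.1, e.injective.eq_iff]

/-- The height is the first return time of `z` to the `x`-cycle of the corner. With
`Intertwines.minimalPeriod`, the marked corner therefore determines both dimensions. -/
theorem Intertwines.isLeast [Finite α]
    (h : Intertwines (torusRot a b) (torusTwist a b j) x z e) :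
    IsLeast {k : ℕ | 0 < k ∧ x.SameCycle (e (0, 0)) ((z ^ k) (e (0, 0)))} (b + 1) := by
  have hz := pow_apply_embedding h.2
  have hx := pow_apply_embedding h.1
  refine ⟨⟨Nat.succ_pos b, sameCycle_iff_exists_nat.2 ⟨j.val, ?_⟩⟩, ?_⟩
  · rw [hz, hx, torusTwist_pow_height, torusRot_pow_val_apply]
  · rintro k ⟨hk, hs⟩
    by_contra hlt
    obtain ⟨n, hn⟩ := sameCycle_iff_exists_nat.1 hs
    rw [hz, hx, torusRot_pow_apply, torusTwist_pow_apply (by omega), e.injective.eq_iff,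
      Prod.mk.injEq] at hn
    have := congrArg Fin.val hn.2
    simp at this
    omega

/-- The corner generates the torus under `x` and `z`, and the twist is read off from one full
vertical turn. -/
theorem Intertwines.unique {j' : Fin (a + 1)} {e' : Fin (a + 1) × Fin (b + 1) ↪ α}
    (h : Intertwines (torusRot a b) (torusTwist a b j) x z e)
    (h' : Intertwines (torusRot a b) (torusTwist a b j') x z e') (h0 : e (0, 0) = e' (0, 0)) :
    j = j' ∧ e = e' := by
  have he : e = e' := by
    ext ⟨u, v⟩
    rw [h.apply_eq, h'.apply_eq, h0]
  subst he
  refine ⟨?_, rfl⟩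
  have hz := pow_apply_embedding h.2
    (b + 1) (0, 0)
  have hz' := pow_apply_embedding h'.2
    (b + 1) (0, 0)
  rw [hz, torusTwist_pow_height, torusTwist_pow_height, e.injective.eq_iff] at hz'
  simpa using hz'

theorem pow_val_add_apply {x : Perm α} {q : α} (hq : Function.minimalPeriod x q = a + 1)
    (u t : Fin (a + 1)) : (x ^ (u + t).val) q = (x ^ (u.val + t.val)) q := by
  have h := Function.iterate_mod_minimalPeriod_eq (f := x) (x := q) (n := u.val + t.val)
  rwa [hq, Perm.iterate_eq_pow, Perm.iterate_eq_pow, ← Fin.val_add] at h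

/-- The width is the length of the `x`-cycle of `p`, the height is the first return time of `z` to
that cycle, and the twist is the displacement at the return. -/
theorem exists_intertwines [Finite α] {x z : Perm α} (hc : z * x = x * z) (p : α) :
    ∃ (a b : ℕ) (j : Fin (a + 1)) (e : Fin (a + 1) × Fin (b + 1) ↪ α),
      Intertwines (torusRot a b) (torusTwist a b j) x z e ∧ e (0, 0) = p := by
  obtain ⟨a, ha⟩ := Nat.exists_eq_succ_of_ne_zero (minimalPeriod_perm_pos x p).ne'
  have hex : ∃ k : ℕ, 0 < k ∧ x.SameCycle p ((z ^ k) p) := by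
    refine ⟨Function.minimalPeriod z p, minimalPeriod_perm_pos z p, ?_⟩
    rw [← Perm.iterate_eq_pow, Function.iterate_minimalPeriod]
  classical
  obtain ⟨b, hb⟩ := Nat.exists_eq_succ_of_ne_zero (Nat.find_spec hex).1.ne'
  have hb2 : x.SameCycle p ((z ^ (b + 1)) p) := by
    rw [← Nat.succ_eq_add_one, ← hb]; exact (Nat.find_spec hex).2
  have hbmin : ∀ k, 0 < k → k ≤ b → ¬ x.SameCycle p ((z ^ k) p) := fun k hk hkb hs =>
    Nat.find_min hex (by rw [hb]; omega) ⟨hk, hs⟩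
  have hzx : ∀ k : ℕ, z ^ k * x = x * z ^ k := fun k =>
    ((show Commute z x from hc).pow_left k).eq
  have hper : ∀ k : ℕ, Function.minimalPeriod x ((z ^ k) p) = a + 1 := fun k =>
    (period_apply (hzx k) p).trans ha
  obtain ⟨n, hn⟩ := sameCycle_iff_exists_nat.1 hb2
  set j : Fin (a + 1) := Fin.ofNat (a + 1) n with hj
  have hjn : (x ^ j.val) p = (z ^ (b + 1)) p := by
    rw [← hn, hj, Fin.val_ofNat, ← Perm.iterate_eq_pow, ← Perm.iterate_eq_pow, ← Nat.succ_eq_add_one,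
      ← ha, Function.iterate_mod_minimalPeriod_eq]
  -- Distinct rows lie in distinct `x`-cycles: otherwise cancelling `z ^ v` would give an earlier
  -- return than `b + 1`.
  have hlt : ∀ (u u' : Fin (a + 1)) (v v' : Fin (b + 1)), v.val < v'.val →
      (x ^ u.val) ((z ^ v.val) p) ≠ (x ^ u'.val) ((z ^ v'.val) p) := by
    intro u u' v v' hv heq
    refine hbmin (v'.val - v.val) (by omega) (by omega) ?_
    have h1 : x.SameCycle ((z ^ v.val) p) ((z ^ v'.val) p) := by
      rw [← Perm.sameCycle_pow_left (n := u.val), heq, Perm.sameCycle_pow_left]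
    have hinv : (z ^ v.val)⁻¹ * x = x * (z ^ v.val)⁻¹ :=
      ((show Commute (z ^ v.val) x from hzx _).inv_left).eq
    have h2 := sameCycle_apply hinv h1
    have h3 : z ^ v'.val = z ^ v.val * z ^ (v'.val - v.val) := by
      rw [← pow_add]; congr 1; omega
    rwa [inv_apply_apply, h3, Perm.mul_apply, inv_apply_apply] at h2
  refine ⟨a, b, j, ⟨fun t => (x ^ t.1.val) ((z ^ t.2.val) p), ?_⟩, ⟨?_, ?_⟩, rfl⟩
  · rintro ⟨u, v⟩ ⟨u', v'⟩ heq
    simp only at heq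
    rcases lt_trichotomy v.val v'.val with h | h | h
    · exact absurd heq (hlt _ _ _ _ h)
    · have hv : v = v' := Fin.ext h
      subst hv
      rw [← Perm.iterate_eq_pow x, ← Perm.iterate_eq_pow x,
        Function.iterate_eq_iterate_iff_of_lt_minimalPeriod (by rw [hper]; exact u.2)
          (by rw [hper]; exact u'.2)] at heq
      rw [Fin.ext heq]
    · exact absurd heq.symm (hlt _ _ _ _ h)
  · rintro ⟨u, v⟩
    change x ((x ^ u.val) ((z ^ v.val) p)) = (x ^ (u + 1).val) ((z ^ v.val) p)
    have := Function.iterate_mod_minimalPeriod_eq (f := x) (x := (z ^ v.val) p) (n := u.val + 1)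
    rw [hper, Perm.iterate_eq_pow, Perm.iterate_eq_pow] at this
    rw [← Perm.mul_apply, ← pow_succ', ← this, Fin.val_add]
    simp
  · rintro ⟨u, v⟩
    change z ((x ^ u.val) ((z ^ v.val) p)) = (x ^ (u + if v = Fin.last b then j else 0).val)
      ((z ^ (v + 1).val) p)
    rw [commute_pow hc, ← Perm.mul_apply z, ← pow_succ' z]
    split_ifs with hv
    · subst hv
      rw [Fin.last_add_one, Fin.val_zero, pow_zero, Perm.one_apply, pow_val_add_apply ha, pow_add x,
        Perm.mul_apply, hjn, Fin.val_last]
    · rw [add_zero]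
      congr 3
      rw [Fin.val_add_one, if_neg hv]

end Embeddings

/-! ### Splitting permutations along an embedded subset -/

section Glue

variable {T α : Type*} (e : T ↪ α)

open Classical in
/-- A type is the disjoint union of the image of an embedding and its complement. -/
noncomputable def sumComplRange : T ⊕ {a // a ∉ Set.range e} ≃ α :=
  (Equiv.sumCongr (Equiv.ofInjective e e.injective) (Equiv.refl _)).trans
    (Equiv.Set.sumCompl (Set.range e))

theorem sumComplRange_inl (t : T) : sumComplRange e (Sum.inl t) = e t := rfl

theorem sumComplRange_inr (a : {a // a ∉ Set.range e}) : sumComplRange e (Sum.inr a) = a := rfl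

theorem sumComplRange_symm_apply (t : T) : (sumComplRange e).symm (e t) = Sum.inl t := by
  rw [Equiv.symm_apply_eq]; rfl

/-- The permutation acting as `σ` on the image of `e` and as `τ` on its complement. -/
noncomputable def glue (σ : Perm T) (τ : Perm {a // a ∉ Set.range e}) : Perm α :=
  (sumComplRange e).permCongr (Perm.sumCongr σ τ)

theorem glue_apply (σ : Perm T) (τ : Perm {a // a ∉ Set.range e}) (t : T) :
    glue e σ τ (e t) = e (σ t) := by
  rw [glue, Equiv.permCongr_apply, sumComplRange_symm_apply]; rfl

theorem glue_injective (σ : Perm T) : Function.Injective (glue e σ) := by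
  intro τ τ' h
  have := (sumComplRange e).permCongr.injective h
  exact (Prod.mk.inj (Perm.sumCongrHom_injective (a₁ := (σ, τ)) (a₂ := (σ, τ')) this)).2

/-- Since `σ` is onto, `x` permutes the image of `e`, hence also its complement. -/
theorem exists_glue_eq {σ : Perm T} {x : Perm α} (h : ∀ t, x (e t) = e (σ t)) :
    ∃ τ, glue e σ τ = x := by
  have hr : ∀ a, x a ∉ Set.range e ↔ a ∉ Set.range e := by
    intro a
    rw [not_iff_not]
    constructor
    · rintro ⟨t, ht⟩
      refine ⟨σ⁻¹ t, x.injective ?_⟩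
      rw [h, ← ht]; simp
    · rintro ⟨t, rfl⟩
      exact ⟨σ t, (h t).symm⟩
  refine ⟨x.subtypePerm hr, ?_⟩
  ext a
  obtain ⟨c, rfl⟩ := (sumComplRange e).surjective a
  rcases c with t | c
  · rw [sumComplRange_inl, glue_apply, h]
  · rw [glue, Equiv.permCongr_apply, Equiv.symm_apply_apply]; rfl

theorem sum_extending [Fintype α] [DecidableEq α] [Fintype (Perm {a // a ∉ Set.range e})]
    {M : Type*} [AddCommMonoid M] (σ : Perm T)
    [DecidablePred fun x : Perm α => ∀ t, x (e t) = e (σ t)] (g : Perm α → M) :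
    (∑ x : Perm α, if ∀ t, x (e t) = e (σ t) then g x else 0) = ∑ τ, g (glue e σ τ) := by
  rw [← Finset.sum_filter]
  symm
  refine Finset.sum_bij (fun τ _ => glue e σ τ) ?_ ?_ ?_ ?_
  · intro τ _; simp [glue_apply]
  · intro τ _ τ' _ h; exact glue_injective e σ h
  · intro x hx
    obtain ⟨τ, hτ⟩ := exists_glue_eq e (Finset.mem_filter.1 hx).2
    exact ⟨τ, Finset.mem_univ _, hτ⟩
  · intros; rfl

theorem glue_mul (σ σ' : Perm T) (τ τ' : Perm {a // a ∉ Set.range e}) :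
    glue e σ τ * glue e σ' τ' = glue e (σ * σ') (τ * τ') := by
  unfold glue
  rw [← Perm.sumCongr_mul]
  exact ((sumComplRange e).permCongrHom.map_mul _ _).symm

theorem glue_comm {σ σ' : Perm T} (h : σ' * σ = σ * σ') {τ τ' : Perm {a // a ∉ Set.range e}} :
    glue e σ' τ' * glue e σ τ = glue e σ τ * glue e σ' τ' ↔ τ' * τ = τ * τ' := by
  rw [glue_mul, glue_mul, h, (glue_injective e _).eq_iff]

theorem minimalPeriod_glue (σ : Perm T) (τ : Perm {a // a ∉ Set.range e}) (t : T) :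
    Function.minimalPeriod (glue e σ τ) (e t) = Function.minimalPeriod σ t := by
  rw [← sumComplRange_inl, glue, minimalPeriod_permCongr, minimalPeriod_sumCongr_inl]

theorem minimalPeriod_glue_compl (σ : Perm T) (τ : Perm {a // a ∉ Set.range e})
    (a : {a // a ∉ Set.range e}) :
    Function.minimalPeriod (glue e σ τ) a = Function.minimalPeriod τ a := by
  rw [← sumComplRange_inr, glue, minimalPeriod_permCongr, minimalPeriod_sumCongr_inr]

theorem card_compl_range [Fintype T] [Fintype α] [Fintype {a // a ∉ Set.range e}] :
    Fintype.card {a // a ∉ Set.range e} = Fintype.card α - Fintype.card T := by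
  rw [← Fintype.card_congr (sumComplRange e), Fintype.card_sum, Nat.add_sub_cancel_left]

end Glue

/-! ### Weighted sums over commuting pairs and the marked-point identity -/

section PairSums

variable {α β : Type*} [Fintype α] [DecidableEq α] [Fintype β] [DecidableEq β] (ζ : ℕ → ℂ)

/-- The weight of a pair of commuting permutations. -/
noncomputable def pairWeight (x z : Perm α) : MvPowerSeries ℕ ℂ :=
  MvPowerSeries.C (cycleCharacter ζ x z) * cycleMonomial z

open Classical in
/-- The sum of the weights of the commuting pairs whose first entry satisfies `P`. -/
noncomputable def pairSum (P : Perm α → Prop) : MvPowerSeries ℕ ℂ :=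
  ∑ x : Perm α, ∑ z : Perm α, if P x ∧ z * x = x * z then pairWeight ζ x z else 0

/-- All cycles of `x` have even length. -/
def AllEven (x : Perm α) : Prop := ∀ a, Even (Function.minimalPeriod x a)

variable {ζ}

theorem pairSum_permCongr (hζ : ∀ i : ℕ, 0 < i → IsPrimitiveRoot (ζ i) i) (e : α ≃ β)
    {P : Perm α → Prop} {Q : Perm β → Prop} (h : ∀ x, P x ↔ Q (e.permCongr x)) :
    pairSum ζ P = pairSum ζ Q := by
  unfold pairSum
  refine Fintype.sum_equiv e.permCongr _ _ fun x => ?_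
  refine Fintype.sum_equiv e.permCongr _ _ fun z => ?_
  have hc : e.permCongr z * e.permCongr x = e.permCongr x * e.permCongr z ↔ z * x = x * z := by
    rw [← e.permCongr.injective.eq_iff (a := z * x), Equiv.permCongr_mul, Equiv.permCongr_mul]
  classical
  refine if_ctx_congr (and_congr (h x) hc.symm) (fun hh => ?_) fun _ => rfl
  rw [pairWeight, pairWeight, cycleCharacter_permCongr hζ e (hc.1 hh.2), cycleMonomial_permCongr]

theorem pairSum_allEven_congr (hζ : ∀ i : ℕ, 0 < i → IsPrimitiveRoot (ζ i) i) (e : α ≃ β) :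
    pairSum ζ (AllEven (α := α)) = pairSum ζ (AllEven (α := β)) := by
  refine pairSum_permCongr hζ e fun x => ⟨fun h b => ?_, fun h a => ?_⟩
  · rw [← e.apply_symm_apply b, minimalPeriod_permCongr]; exact h _
  · rw [← minimalPeriod_permCongr e]; exact h _

variable {T : Type*} [Fintype T] [DecidableEq T]

open Classical in
theorem pairWeight_glue (hζ : ∀ i : ℕ, 0 < i → IsPrimitiveRoot (ζ i) i) (e : T ↪ α)
    {σ σ' : Perm T} (h : σ' * σ = σ * σ') {τ τ' : Perm {a // a ∉ Set.range e}}
    (h' : τ' * τ = τ * τ') :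
    pairWeight ζ (glue e σ τ) (glue e σ' τ') = pairWeight ζ σ σ' * pairWeight ζ τ τ' := by
  have hc : Perm.sumCongr σ' τ' * Perm.sumCongr σ τ = Perm.sumCongr σ τ * Perm.sumCongr σ' τ' := by
    rw [Perm.sumCongr_mul, Perm.sumCongr_mul, h, h']
  rw [pairWeight, glue, glue, cycleCharacter_permCongr hζ _ hc, cycleMonomial_permCongr,
    cycleCharacter_sumCongr hζ h h', cycleMonomial_sumCongr, map_mul, pairWeight, pairWeight]
  ring

-- With `e` fixed, the pair is prescribed on the image; only a pair on the complement remains free.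
-- It commutes exactly when the glued pair does, and the weight factors.
open Classical in
theorem sum_intertwining (hζ : ∀ i : ℕ, 0 < i → IsPrimitiveRoot (ζ i) i) (e : T ↪ α)
    {σ σ' : Perm T} (h : σ' * σ = σ * σ') (P : Perm α → Prop) :
    (∑ x : Perm α, ∑ z : Perm α,
      if Intertwines σ σ' x z e ∧ P x ∧ z * x = x * z then pairWeight ζ x z else 0) =
    pairWeight ζ σ σ' * pairSum ζ fun τ => P (glue e σ τ) := by
  calc _ = ∑ x : Perm α, if ∀ t, x (e t) = e (σ t) then
        (∑ z : Perm α, if ∀ t, z (e t) = e (σ' t) then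
          (if P x ∧ z * x = x * z then pairWeight ζ x z else 0) else 0) else 0 := by
        refine Finset.sum_congr rfl fun x _ => ?_
        split_ifs with hx
        · refine Finset.sum_congr rfl fun z _ => ?_
          simp only [Intertwines, hx, implies_true, true_and, ite_and]
        · refine Finset.sum_eq_zero fun z _ => if_neg fun hh => hx hh.1.1
    _ = _ := by
        rw [sum_extending]
        simp_rw [sum_extending]
        rw [pairSum, Finset.mul_sum]
        refine Finset.sum_congr rfl fun τ _ => ?_
        rw [Finset.mul_sum]
        refine Finset.sum_congr rfl fun τ' _ => ?_
        rw [mul_ite, mul_zero]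
        exact if_ctx_congr (and_congr Iff.rfl (glue_comm e h))
          (fun hh => pairWeight_glue hζ e h hh.2) fun _ => rfl

-- Every point is the corner of exactly one embedded torus, so counting embeddings counts points.
-- The ranges suffice because `(a + 1) * (b + 1)` is at most the number of points.
open Classical in
theorem sum_card_intertwines {x z : Perm α} (hc : z * x = x * z) :
    ∑ a ∈ Finset.range (Fintype.card α), ∑ b ∈ Finset.range (Fintype.card α), ∑ j : Fin (a + 1),
      ((Finset.univ.filter fun e : Fin (a + 1) × Fin (b + 1) ↪ α =>
        Intertwines (torusRot a b) (torusTwist a b j) x z e).card) = Fintype.card α := by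
  have key : ∀ p : α, ∑ a ∈ Finset.range (Fintype.card α), ∑ b ∈ Finset.range (Fintype.card α),
      ∑ j : Fin (a + 1), ((Finset.univ.filter fun e : Fin (a + 1) × Fin (b + 1) ↪ α =>
        Intertwines (torusRot a b) (torusTwist a b j) x z e ∧ e (0, 0) = p).card) = 1 := by
    intro p
    obtain ⟨a, b, j, e, he, hp⟩ := exists_intertwines hc p
    have hcard : (a + 1) * (b + 1) ≤ Fintype.card α := by
      simpa using Fintype.card_le_of_embedding e
    have zero : ∀ (a' b' : ℕ) (j' : Fin (a' + 1)), ¬ (a' = a ∧ b' = b) →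
        (Finset.univ.filter fun e : Fin (a' + 1) × Fin (b' + 1) ↪ α =>
          Intertwines (torusRot a' b') (torusTwist a' b' j') x z e ∧ e (0, 0) = p).card = 0 := by
      intro a' b' j' hne
      rw [Finset.card_eq_zero, Finset.filter_eq_empty_iff]
      rintro e' - ⟨he', hp'⟩
      have h1 := he.minimalPeriod
      have h2 := he'.minimalPeriod
      have h3 := he.isLeast
      have h4 := he'.isLeast
      rw [hp] at h1 h3
      rw [hp'] at h2 h4
      have := h3.unique h4
      exact hne ⟨by omega, by omega⟩
    rw [Finset.sum_eq_single a, Finset.sum_eq_single b, Finset.sum_eq_single j, Finset.card_eq_one]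
    · refine ⟨e, ?_⟩
      ext e'
      simp only [Finset.mem_filter, Finset.mem_univ, true_and, Finset.mem_singleton]
      constructor
      · rintro ⟨he', hp'⟩
        exact (he'.unique he (hp'.trans hp.symm)).2
      · rintro rfl
        exact ⟨he, hp⟩
    · intro j' _ hj
      rw [Finset.card_eq_zero, Finset.filter_eq_empty_iff]
      rintro e' - ⟨he', hp'⟩
      exact hj (he'.unique he (hp'.trans hp.symm)).1
    · simp
    · intro b' _ hb
      exact Finset.sum_eq_zero fun j' _ => zero _ _ _ fun h => hb h.2
    · intro h
      exact absurd (Finset.mem_range.2 (by nlinarith)) h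
    · intro a' _ ha
      exact Finset.sum_eq_zero fun b' _ => Finset.sum_eq_zero fun j' _ => zero _ _ _ fun h => ha h.1
    · intro h
      exact absurd (Finset.mem_range.2 (by nlinarith)) h
  have h1 := Finset.sum_congr rfl fun (p : α) (_ : p ∈ Finset.univ) => key p
  rw [Finset.sum_const, Finset.card_univ, smul_eq_mul, mul_one] at h1
  refine Eq.trans ?_ h1
  symm
  rw [Finset.sum_comm]
  refine Finset.sum_congr rfl fun a _ => ?_
  rw [Finset.sum_comm]
  refine Finset.sum_congr rfl fun b _ => ?_
  rw [Finset.sum_comm]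
  refine Finset.sum_congr rfl fun j _ => ?_
  symm
  rw [Finset.card_eq_sum_card_fiberwise (f := fun e : Fin (a + 1) × Fin (b + 1) ↪ α => e (0, 0))
    (t := Finset.univ) (fun _ _ => Finset.mem_coe.2 (Finset.mem_univ _))]
  simp only [Finset.filter_filter]

theorem sum_sum_comm {ι κ M : Type*} [Fintype κ] [AddCommMonoid M] (s : Finset ι)
    (f : κ → κ → ι → M) : ∑ x, ∑ z, ∑ i ∈ s, f x z i = ∑ i ∈ s, ∑ x, ∑ z, f x z i := by
  simp_rw [Finset.sum_comm (t := s)]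

-- Marking a point multiplies the sum by the number of points; the marked point is then traded for
-- the torus of which it is the corner.
open Classical in
theorem card_mul_pairSum (hζ : ∀ i : ℕ, 0 < i → IsPrimitiveRoot (ζ i) i) (P : Perm α → Prop) :
    (Fintype.card α : MvPowerSeries ℕ ℂ) * pairSum ζ P =
    ∑ a ∈ Finset.range (Fintype.card α), ∑ b ∈ Finset.range (Fintype.card α), ∑ j : Fin (a + 1),
      ∑ e : Fin (a + 1) × Fin (b + 1) ↪ α,
        pairWeight ζ (torusRot a b) (torusTwist a b j) *
          pairSum ζ fun τ => P (glue e (torusRot a b) τ) := by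
  simp_rw [← sum_intertwining hζ _ torus_comm P]
  rw [pairSum, Finset.mul_sum]
  have hx : ∀ x z : Perm α, (Fintype.card α : MvPowerSeries ℕ ℂ) *
      (if P x ∧ z * x = x * z then pairWeight ζ x z else 0) =
      ∑ a ∈ Finset.range (Fintype.card α), ∑ b ∈ Finset.range (Fintype.card α), ∑ j : Fin (a + 1),
        ∑ e : Fin (a + 1) × Fin (b + 1) ↪ α,
        if Intertwines (torusRot a b) (torusTwist a b j) x z e ∧ P x ∧ z * x = x * z
          then pairWeight ζ x z else 0 := by
    intro x z
    by_cases h : P x ∧ z * x = x * z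
    · have hcard := sum_card_intertwines h.2
      simp only [h, and_true, if_true, ← Finset.sum_filter, Finset.sum_const]
      simp only [nsmul_eq_mul, ← Finset.sum_mul]
      congr 1
      replace hcard := congrArg (Nat.cast (R := MvPowerSeries ℕ ℂ)) hcard
      push_cast at hcard
      convert hcard.symm
    · simp [h]
  simp_rw [Finset.mul_sum, hx]
  rw [sum_sum_comm]
  refine Finset.sum_congr rfl fun a _ => ?_
  rw [sum_sum_comm]
  refine Finset.sum_congr rfl fun b _ => ?_
  rw [sum_sum_comm]
  refine Finset.sum_congr rfl fun j _ => ?_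
  rw [sum_sum_comm]

end PairSums

/-! ### Recursion for permutations with even cycles only -/

section Recursion

variable {ζ : ℕ → ℂ}

/-- The pair sum over permutations of `Fin n` with even cycles, divided by `n!`. -/
noncomputable def evenSeries (ζ : ℕ → ℂ) (n : ℕ) : MvPowerSeries ℕ ℂ :=
  MvPowerSeries.C ((n.factorial : ℂ)⁻¹) * pairSum ζ (AllEven (α := Fin n))

/-- The contribution of the discrete tori with `i` columns and `k` rows. -/
noncomputable def torusSum (i k : ℕ) : MvPowerSeries ℕ ℂ :=
  ∑ η ∈ Polynomial.nthRootsFinset i (1 : ℂ),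
    MvPowerSeries.C η * signedVar (k * orderOf η) ^ (i / orderOf η)

/-- The contribution of all discrete tori with `N` points and an even number of columns. -/
noncomputable def evenTorusSum (N : ℕ) : MvPowerSeries ℕ ℂ :=
  ∑ p ∈ N.divisorsAntidiagonal with Even p.1, torusSum p.1 p.2

/-- The map `j ↦ ζ (a + 1) ^ j` is an order-preserving bijection from twists to roots of unity, in
the sense that additive order becomes multiplicative order. The result no longer depends on the
choice of `ζ`. -/
theorem sum_pairWeight_torus (hζ : ∀ i : ℕ, 0 < i → IsPrimitiveRoot (ζ i) i) (a b : ℕ) :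
    ∑ j : Fin (a + 1), pairWeight ζ (torusRot a b) (torusTwist a b j) =
      torusSum (a + 1) (b + 1) := by
  have hprim := hζ (a + 1) (Nat.succ_pos a)
  have hord : ∀ j : Fin (a + 1), orderOf (ζ (a + 1) ^ j.val) = addOrderOf j := by
    intro j
    have hval : ∀ n : ℕ, (n • j).val = n * j.val % (a + 1) := by
      intro n
      induction n with
      | zero => simp
      | succ n ih => rw [succ_nsmul, Fin.val_add, ih, Nat.mod_add_mod, Nat.succ_mul]
    refine Nat.dvd_right_iff_eq.1 fun n => ?_
    rw [orderOf_dvd_iff_pow_eq_one, addOrderOf_dvd_iff_nsmul_eq_zero, ← pow_mul,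
      hprim.pow_eq_one_iff_dvd, Fin.ext_iff, hval, mul_comm]
    exact Nat.dvd_iff_mod_eq_zero
  unfold torusSum
  refine Finset.sum_bij (fun j _ => ζ (a + 1) ^ j.val) ?_ ?_ ?_ ?_
  · intro j _
    rw [Polynomial.mem_nthRootsFinset (Nat.succ_pos a), ← pow_mul, mul_comm, pow_mul,
      hprim.pow_eq_one, one_pow]
  · intro j _ j' _ h
    exact Fin.ext (hprim.pow_inj j.2 j'.2 h)
  · intro η hη
    obtain ⟨j, hj, rfl⟩ := hprim.eq_pow_of_pow_eq_one
      ((Polynomial.mem_nthRootsFinset (Nat.succ_pos a) _).1 hη)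
    exact ⟨⟨j, hj⟩, Finset.mem_univ _, rfl⟩
  · intro j _
    rw [pairWeight, cycleCharacter_torus hζ, cycleMonomial_torusTwist, hord]

theorem allEven_glue_iff {T α : Type*} {e : T ↪ α} {σ : Perm T} {τ : Perm {a // a ∉ Set.range e}} :
    AllEven (glue e σ τ) ↔ AllEven σ ∧ AllEven τ := by
  constructor
  · exact fun h => ⟨fun t => by simpa [minimalPeriod_glue] using h (e t),
      fun a => by simpa [minimalPeriod_glue_compl] using h a⟩
  · rintro ⟨h1, h2⟩ a
    obtain ⟨c, rfl⟩ := (sumComplRange e).surjective a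
    rcases c with t | c
    · rw [sumComplRange_inl, minimalPeriod_glue]; exact h1 t
    · rw [sumComplRange_inr, minimalPeriod_glue_compl]; exact h2 c

theorem allEven_torusRot {a b : ℕ} : AllEven (torusRot a b) ↔ Even (a + 1) := by
  constructor
  · intro h; simpa [minimalPeriod_torusRot] using h (0, 0)
  · intro h p; rwa [minimalPeriod_torusRot]

open Classical in
theorem pairSum_allEven_compl (hζ : ∀ i : ℕ, 0 < i → IsPrimitiveRoot (ζ i) i) {T : Type*}
    [Fintype T] {n : ℕ} (e : T ↪ Fin n) :
    pairSum ζ (AllEven (α := {a // a ∉ Set.range e})) =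
      pairSum ζ (AllEven (α := Fin (n - Fintype.card T))) := by
  refine pairSum_allEven_congr hζ (Fintype.equivFinOfCardEq ?_)
  rw [card_compl_range, Fintype.card_fin]

theorem pairSum_false {α : Type*} [Fintype α] [DecidableEq α] :
    pairSum ζ (fun _ : Perm α => False) = 0 := by
  simp [pairSum]

/-- A torus with `N` points has `n! / (n - N)!` embeddings, which turns the normalization `1 / n!`
into `1 / (n - N)!` for the complement. All tori with `N` points are then collected. -/
theorem natCast_mul_evenSeries (hζ : ∀ i : ℕ, 0 < i → IsPrimitiveRoot (ζ i) i) (n : ℕ) :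
    (n : MvPowerSeries ℕ ℂ) * evenSeries ζ n =
      ∑ p ∈ Finset.HasAntidiagonal.antidiagonal n, evenTorusSum p.1 * evenSeries ζ p.2 := by
  classical
  have h1 := card_mul_pairSum hζ (AllEven (α := Fin n))
  rw [Fintype.card_fin] at h1
  have h2 : ∀ a b : ℕ, ∑ j : Fin (a + 1), ∑ e : Fin (a + 1) × Fin (b + 1) ↪ Fin n,
      pairWeight ζ (torusRot a b) (torusTwist a b j) *
          pairSum ζ (fun τ => AllEven (glue e (torusRot a b) τ)) =
      (n.descFactorial ((a + 1) * (b + 1)) : MvPowerSeries ℕ ℂ) *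
        (if Even (a + 1) then torusSum (a + 1) (b + 1) *
          pairSum ζ (AllEven (α := Fin (n - (a + 1) * (b + 1)))) else 0) := by
    intro a b
    have h3 : ∀ e : Fin (a + 1) × Fin (b + 1) ↪ Fin n,
        pairSum ζ (fun τ => AllEven (glue e (torusRot a b) τ)) =
        if Even (a + 1) then pairSum ζ (AllEven (α := Fin (n - (a + 1) * (b + 1)))) else 0 := by
      intro e
      simp only [allEven_glue_iff, allEven_torusRot]
      split_ifs with h
      · have := pairSum_allEven_compl hζ e
        rw [Fintype.card_prod, Fintype.card_fin, Fintype.card_fin] at this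
        simp only [h, true_and]
        exact this
      · simp only [h, false_and]
        exact pairSum_false
    simp only [h3, Finset.sum_const, Finset.card_univ, Fintype.card_embedding_eq, Fintype.card_prod,
      Fintype.card_fin, nsmul_eq_mul, ← Finset.mul_sum, ← Finset.sum_mul, sum_pairWeight_torus hζ]
    rw [mul_ite, mul_zero]
  simp only [h2] at h1
  have h4 : (n : MvPowerSeries ℕ ℂ) * evenSeries ζ n =
      ∑ q ∈ Finset.range n ×ˢ Finset.range n with (q.1 + 1) * (q.2 + 1) ≤ n,
        (if Even (q.1 + 1) then torusSum (q.1 + 1) (q.2 + 1) else 0) *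
          evenSeries ζ (n - (q.1 + 1) * (q.2 + 1)) := by
    rw [evenSeries, mul_left_comm, h1, ← Finset.sum_product', Finset.mul_sum, Finset.sum_filter]
    refine Finset.sum_congr rfl fun q _ => ?_
    by_cases h5 : (q.1 + 1) * (q.2 + 1) ≤ n
    · rw [if_pos h5, evenSeries]
      have hf : ((n.factorial : ℂ)⁻¹) * (n.descFactorial ((q.1 + 1) * (q.2 + 1)) : ℂ) =
          (((n - (q.1 + 1) * (q.2 + 1)).factorial : ℂ)⁻¹) := by
        rw [← Nat.factorial_mul_descFactorial h5]
        have h7 : ((n - (q.1 + 1) * (q.2 + 1)).factorial : ℂ) ≠ 0 :=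
          Nat.cast_ne_zero.2 (Nat.factorial_ne_zero _)
        have h8 : (n.descFactorial ((q.1 + 1) * (q.2 + 1)) : ℂ) ≠ 0 :=
          Nat.cast_ne_zero.2 fun h0 => absurd (Nat.descFactorial_eq_zero_iff_lt.1 h0) (by omega)
        push_cast
        field_simp
      rw [← hf, map_mul, map_natCast, ite_mul, zero_mul]
      split_ifs
      · ring
      · simp
    · rw [if_neg h5, Nat.descFactorial_eq_zero_iff_lt.2 (not_le.1 h5)]; simp
  rw [h4, Finset.Nat.sum_antidiagonal_eq_sum_range_succ
    (fun k l => evenTorusSum k * evenSeries ζ l)]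
  simp only [evenTorusSum, Finset.sum_mul, Finset.sum_filter]
  -- Dimensions `(a + 1, b + 1)` with product at most `n` correspond to pairs of complementary
  -- divisors of some `N ≤ n`; `N = 0` has none.
  rw [← Finset.sum_filter, Finset.sum_sigma']
  refine Finset.sum_nbij' (fun q => ⟨(q.1 + 1) * (q.2 + 1), (q.1 + 1, q.2 + 1)⟩)
    (fun s => (s.2.1 - 1, s.2.2 - 1)) ?_ ?_ ?_ ?_ ?_
  · rintro ⟨a, b⟩ h
    simp only [Finset.mem_filter, Finset.mem_product, Finset.mem_range] at h
    simp only [Finset.mem_sigma, Finset.mem_range, Nat.mem_divisorsAntidiagonal]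
    exact ⟨by omega, trivial, by positivity⟩
  · rintro ⟨N, i, k⟩ h
    simp only [Finset.mem_sigma, Finset.mem_range, Nat.mem_divisorsAntidiagonal] at h
    obtain ⟨hN, rfl, h0⟩ := h
    obtain ⟨hi, hk⟩ := mul_ne_zero_iff.1 h0
    obtain ⟨i, rfl⟩ := Nat.exists_eq_succ_of_ne_zero hi
    obtain ⟨k, rfl⟩ := Nat.exists_eq_succ_of_ne_zero hk
    simp only [Finset.mem_filter, Finset.mem_product, Finset.mem_range, Nat.succ_eq_add_one,
      Nat.add_sub_cancel] at hN ⊢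
    refine ⟨⟨?_, ?_⟩, by omega⟩ <;> nlinarith
  · rintro ⟨a, b⟩ _; rfl
  · rintro ⟨N, i, k⟩ h
    simp only [Finset.mem_sigma, Finset.mem_range, Nat.mem_divisorsAntidiagonal] at h
    obtain ⟨hN, rfl, h0⟩ := h
    obtain ⟨hi, hk⟩ := mul_ne_zero_iff.1 h0
    obtain ⟨i, rfl⟩ := Nat.exists_eq_succ_of_ne_zero hi
    obtain ⟨k, rfl⟩ := Nat.exists_eq_succ_of_ne_zero hk
    rfl
  · rintro ⟨a, b⟩ _
    simp only [ite_mul, zero_mul]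

theorem evenSeries_zero : evenSeries ζ 0 = 1 := by
  have hx : (1 : Perm (Fin 0)).partition.parts = 0 := by
    rw [Multiset.eq_zero_iff_forall_notMem]
    intro m hm
    obtain ⟨a, -⟩ := (mem_parts_partition_iff _ m).1 hm
    exact a.elim0
  simp [evenSeries, pairSum, AllEven, pairWeight, cycleCharacter, cycleMonomial]
  rw [hx]; simp

end Recursion

/-! ### Allowing a single fixed point -/

section OneFixedPoint

variable {ζ : ℕ → ℂ}

/-- One point is fixed by `x`, and all other cycles have even length. -/
def OneFixed {α : Type*} (x : Perm α) : Prop :=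
  ∃ p, x p = p ∧ ∀ a, a ≠ p → Even (Function.minimalPeriod x a)

theorem not_oneFixed_of_allEven {α : Type*} {x : Perm α} (h : AllEven x) : ¬ OneFixed x := by
  rintro ⟨p, hp, -⟩
  have := h p
  rw [Function.minimalPeriod_eq_one_iff_isFixedPt.2 hp] at this
  exact absurd this (by decide)

theorem eq_of_apply_eq_of_even {α : Type*} {x : Perm α} {p q : α}
    (h : ∀ a, a ≠ p → Even (Function.minimalPeriod x a)) (hq : x q = q) : q = p := by
  by_contra hne
  have := h q hne
  rw [Function.minimalPeriod_eq_one_iff_isFixedPt.2 hq] at this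
  exact absurd this (by decide)

theorem pairWeight_torus_point (hζ : ∀ i : ℕ, 0 < i → IsPrimitiveRoot (ζ i) i) :
    pairWeight ζ (torusRot 0 0) (torusTwist 0 0 0) = MvPowerSeries.X 1 := by
  rw [pairWeight, cycleCharacter_torus hζ, cycleMonomial_torusTwist]
  simp [signedVar]

/-- The only fixed point of `x` is also fixed by the commuting `z`, so it splits off as a one-point
torus of weight `t_1`, in `n` possible positions. At `n = 0` the factor `n` makes the truncated `n -
1` harmless. -/
theorem pairSum_oneFixed (hζ : ∀ i : ℕ, 0 < i → IsPrimitiveRoot (ζ i) i) (n : ℕ) :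
    pairSum ζ (OneFixed (α := Fin n)) =
      (n : MvPowerSeries ℕ ℂ) * (MvPowerSeries.X 1 * pairSum ζ (AllEven (α := Fin (n - 1)))) := by
  classical
  have : Subsingleton (Fin (0 + 1) × Fin (0 + 1)) := inferInstanceAs (Subsingleton (Fin 1 × Fin 1))
  obtain ⟨P, hP⟩ : ∃ P : (Fin (0 + 1) × Fin (0 + 1) ↪ Fin n) → Perm (Fin n) → Prop,
      ∀ e x, P e x ↔ ∀ a, a ≠ e (0, 0) → Even (Function.minimalPeriod x a) :=
    ⟨_, fun _ _ => Iff.rfl⟩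
  have h1 : ∀ e : Fin (0 + 1) × Fin (0 + 1) ↪ Fin n,
      (∑ x : Perm (Fin n), ∑ z : Perm (Fin n), if Intertwines (torusRot 0 0) (torusTwist 0 0 0) x z e
        ∧ P e x ∧ z * x = x * z
        then pairWeight ζ x z else 0) =
      MvPowerSeries.X 1 * pairSum ζ (AllEven (α := Fin (n - 1))) := by
    intro e
    rw [sum_intertwining hζ e torus_comm (P e), pairWeight_torus_point hζ]
    have h2 := pairSum_allEven_compl hζ e
    rw [Fintype.card_prod, Fintype.card_fin] at h2
    rw [← h2]
    congr 2
    ext τ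
    rw [hP]
    constructor
    · intro h a
      rw [← minimalPeriod_glue_compl e (torusRot 0 0)]
      exact h _ fun hh => a.2 ⟨_, hh.symm⟩
    · intro h a ha
      obtain ⟨c, rfl⟩ := (sumComplRange e).surjective a
      rcases c with t | c
      · exact absurd (by rw [sumComplRange_inl, Subsingleton.elim t (0, 0)]) ha
      · rw [sumComplRange_inr, minimalPeriod_glue_compl]; exact h c
  have h3 := Finset.sum_congr rfl fun (e : Fin (0 + 1) × Fin (0 + 1) ↪ Fin n)
    (_ : e ∈ Finset.univ) => h1 e
  rw [Finset.sum_const, Finset.card_univ, Fintype.card_embedding_eq, Fintype.card_prod,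
    Fintype.card_fin, Fintype.card_fin, nsmul_eq_mul, Nat.descFactorial_one] at h3
  rw [← h3, ← sum_sum_comm, pairSum]
  refine Finset.sum_congr rfl fun x _ => Finset.sum_congr rfl fun z _ => ?_
  by_cases h : OneFixed x ∧ z * x = x * z
  · rw [if_pos h]
    obtain ⟨⟨p, hp, he⟩, hc⟩ := h
    have hz : z p = p := eq_of_apply_eq_of_even he (by
      rw [← Perm.mul_apply, ← hc, Perm.mul_apply, hp])
    symm
    rw [Finset.sum_eq_single (⟨fun _ => p, fun _ _ _ => Subsingleton.elim _ _⟩ :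
      Fin (0 + 1) × Fin (0 + 1) ↪ Fin n), if_pos]
    · exact ⟨⟨fun _ => hp, fun _ => hz⟩, (hP _ _).2 he, hc⟩
    · intro e _ hne
      refine if_neg fun hh => hne ?_
      ext t
      have hfix : x (e (0, 0)) = e (0, 0) := by
        rw [hh.1.1]; exact congrArg e (Subsingleton.elim _ _)
      rw [Subsingleton.elim t (0, 0), eq_of_apply_eq_of_even he hfix]
      rfl
    · simp
  · rw [if_neg h]
    symm
    refine Finset.sum_eq_zero fun e _ => if_neg fun hh => h ⟨⟨e (0, 0), ?_, (hP _ _).1 hh.2.1⟩, hh.2.2⟩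
    rw [hh.1.1]; exact congrArg e (Subsingleton.elim _ _)

/-- All cycles of `x` have even length, except possibly for a single fixed point. -/
def AllEvenButOne {α : Type*} (x : Perm α) : Prop := AllEven x ∨ OneFixed x

/-- The pair sum over permutations of `Fin n` whose cycle type is in `EP n`, divided by `n!`. -/
noncomputable def epSeries (ζ : ℕ → ℂ) (n : ℕ) : MvPowerSeries ℕ ℂ :=
  MvPowerSeries.C ((n.factorial : ℂ)⁻¹) * pairSum ζ (AllEvenButOne (α := Fin n))

theorem pairSum_allEvenButOne {α : Type*} [Fintype α] [DecidableEq α] :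
    pairSum ζ (AllEvenButOne (α := α)) =
      pairSum ζ (AllEven (α := α)) + pairSum ζ (OneFixed (α := α)) := by
  simp only [pairSum, ← Finset.sum_add_distrib]
  refine Finset.sum_congr rfl fun x _ => Finset.sum_congr rfl fun z _ => ?_
  have := not_oneFixed_of_allEven (x := x)
  classical
  by_cases h1 : AllEven x
  · rw [if_neg (c := OneFixed x ∧ _) fun h => this h1 h.1, add_zero]
    exact if_ctx_congr (by simp [AllEvenButOne, h1]) (fun _ => rfl) fun _ => rfl
  · rw [if_neg (c := AllEven x ∧ _) fun h => h1 h.1, zero_add]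
    exact if_ctx_congr (by simp [AllEvenButOne, h1]) (fun _ => rfl) fun _ => rfl

theorem epSeries_zero (hζ : ∀ i : ℕ, 0 < i → IsPrimitiveRoot (ζ i) i) : epSeries ζ 0 = 1 := by
  rw [epSeries, pairSum_allEvenButOne, pairSum_oneFixed hζ, Nat.cast_zero, zero_mul,
    add_zero]
  exact evenSeries_zero

/-- With `epSeries_zero`, this says that the generating function is multiplied by `1 + t_1 X`. -/
theorem epSeries_succ (hζ : ∀ i : ℕ, 0 < i → IsPrimitiveRoot (ζ i) i) (n : ℕ) :
    epSeries ζ (n + 1) = evenSeries ζ (n + 1) + MvPowerSeries.X 1 * evenSeries ζ n := by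
  rw [epSeries, pairSum_allEvenButOne, pairSum_oneFixed hζ, mul_add, evenSeries, evenSeries,
    Nat.add_sub_cancel]
  have hf : (n.factorial : ℂ)⁻¹ = ((n + 1).factorial : ℂ)⁻¹ * ((n + 1 : ℕ) : ℂ) := by
    rw [Nat.factorial_succ]
    have : ((n + 1 : ℕ) : ℂ) ≠ 0 := Nat.cast_ne_zero.2 (Nat.succ_ne_zero n)
    push_cast at this ⊢
    field_simp
  rw [hf, map_mul, map_natCast]
  ring

end OneFixedPoint

/-! ### Sums of roots of unity and evaluation of the torus contributions -/

section RootSums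

/-- The sum of the primitive complex `e`-th roots of unity. -/
noncomputable def primRootSum (e : ℕ) : ℂ := ∑ η ∈ primitiveRoots e ℂ, η

theorem sum_nthRootsFinset_eq {M : Type*} [AddCommMonoid M] {i : ℕ} (hi : 0 < i) (f : ℂ → M) :
    ∑ η ∈ Polynomial.nthRootsFinset i (1 : ℂ), f η =
      ∑ e ∈ i.divisors, ∑ η ∈ primitiveRoots e ℂ, f η := by
  have : NeZero i := ⟨hi.ne'⟩
  rw [IsPrimitiveRoot.nthRoots_one_eq_biUnion_primitiveRoots, Finset.sum_biUnion]
  exact fun a _ b _ hab => IsPrimitiveRoot.disjoint hab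

/-- The primitive roots of all orders dividing `m` make up the `m`-th roots of unity, whose sum is
geometric. This is the defining identity of the Möbius function, and nothing else about
`primRootSum` is needed for the cancellation. -/
theorem sum_divisors_primRootSum {m : ℕ} (hm : 0 < m) :
    ∑ e ∈ m.divisors, primRootSum e = if m = 1 then 1 else 0 := by
  unfold primRootSum
  rw [← sum_nthRootsFinset_eq hm]
  obtain ⟨ω, hprim⟩ : ∃ ω : ℂ, IsPrimitiveRoot ω m := ⟨_, Complex.isPrimitiveRoot_exp m hm.ne'⟩
  have h : ∑ η ∈ Polynomial.nthRootsFinset m (1 : ℂ), η =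
      ∑ j ∈ Finset.range m, ω ^ j := by
    symm
    refine Finset.sum_bij (fun j _ => ω ^ j) ?_ ?_ ?_ ?_
    · intro j _
      rw [Polynomial.mem_nthRootsFinset hm, ← pow_mul, mul_comm, pow_mul, hprim.pow_eq_one, one_pow]
    · intro j hj j' hj' hh
      exact hprim.pow_inj (Finset.mem_range.1 hj) (Finset.mem_range.1 hj') hh
    · intro η hη
      have := NeZero.mk hm.ne'
      obtain ⟨j, hj, rfl⟩ := hprim.eq_pow_of_pow_eq_one ((Polynomial.mem_nthRootsFinset hm _).1 hη)
      exact ⟨j, Finset.mem_range.2 hj, rfl⟩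
    · intros; rfl
  rw [h]
  split_ifs with h1
  · subst h1; simp
  · exact hprim.geom_sum_eq_zero (by omega)

theorem two_pow_mul_odd_inj {r s d q : ℕ} (hd : Odd d) (hq : Odd q) (h : 2 ^ r * d = 2 ^ s * q) :
    r = s ∧ d = q := by
  have aux : ∀ {r s d q : ℕ}, Odd q → 2 ^ r * d = 2 ^ s * q → r ≤ s := by
    intro r s d q hq h
    have hc : Nat.Coprime (2 ^ r) q := Nat.Coprime.pow_left _ (Nat.coprime_two_left.2 hq)
    have : 2 ^ r ∣ 2 ^ s := hc.dvd_of_dvd_mul_right ⟨d, h.symm⟩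
    exact (Nat.pow_dvd_pow_iff_le_right (by norm_num)).1 this
  have hrs := le_antisymm (aux hq h) (aux hd h.symm)
  subst hrs
  exact ⟨rfl, Nat.eq_of_mul_eq_mul_left (by positivity) h⟩

theorem sum_primRootSum_of_even {m d : ℕ} (hm : 0 < m) (hd : Even d) :
    ∑ e ∈ m.divisors with Even (d * e), primRootSum e = if m = 1 then 1 else 0 := by
  rw [← sum_divisors_primRootSum hm]
  congr 1
  exact Finset.filter_true_of_mem fun e _ => hd.mul_right e

/-- The sum runs over the even divisors. Over all divisors the total is zero, and the odd divisors
are those of `s`, so the answer is minus the full divisor sum for `s`. -/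
theorem sum_primRootSum_of_odd {r s d : ℕ} (hd : Odd d) (hs : Odd s) :
    ∑ e ∈ (2 ^ (r + 1) * s).divisors with Even (d * e), primRootSum e =
      if s = 1 then -1 else 0 := by
  have hpos : 0 < 2 ^ (r + 1) * s := Nat.mul_pos (by positivity) hs.pos
  have h1 := sum_divisors_primRootSum hpos
  have hne : 2 ^ (r + 1) * s ≠ 1 := by
    intro h
    have := Nat.eq_one_of_mul_eq_one_right h
    rw [pow_succ] at this
    omega
  rw [if_neg hne, ← Finset.sum_filter_add_sum_filter_not _ fun e => Even (d * e)] at h1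
  have h2 : (2 ^ (r + 1) * s).divisors.filter (fun e => ¬ Even (d * e)) = s.divisors := by
    ext e
    simp only [Finset.mem_filter, Nat.mem_divisors, Nat.not_even_iff_odd, Nat.odd_mul]
    constructor
    · rintro ⟨⟨h, -⟩, -, he⟩
      exact ⟨(Nat.Coprime.pow_right _ (Nat.coprime_two_right.2 he)).dvd_of_dvd_mul_left h,
        hs.pos.ne'⟩
    · rintro ⟨h, -⟩
      exact ⟨⟨Dvd.dvd.mul_left h _, hpos.ne'⟩, hd, Odd.of_dvd_nat hs h⟩
  rw [h2, sum_divisors_primRootSum hs.pos] at h1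
  rw [eq_neg_of_add_eq_zero_left h1]
  split_ifs <;> simp

theorem torusSum_eq {i : ℕ} (hi : 0 < i) (k : ℕ) :
    torusSum i k =
      ∑ e ∈ i.divisors, MvPowerSeries.C (primRootSum e) * signedVar (k * e) ^ (i / e) := by
  rw [torusSum, sum_nthRootsFinset_eq hi]
  refine Finset.sum_congr rfl fun e he => ?_
  rw [primRootSum, map_sum, Finset.sum_mul]
  refine Finset.sum_congr rfl fun η hη => ?_
  rw [← ((mem_primitiveRoots (Nat.pos_of_mem_divisors he)).1 hη).eq_orderOf]

/-- Tori are regrouped by the number `d` and the length `m` of the cycles of `z`: if the twist has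
order `e`, then `i = d * e` and `m = k * e`, so the evenness of `i` becomes that of `d * e`. -/
theorem evenTorusSum_eq (N : ℕ) :
    evenTorusSum N = ∑ p ∈ N.divisorsAntidiagonal,
      MvPowerSeries.C (∑ e ∈ p.2.divisors with Even (p.1 * e), primRootSum e) *
        signedVar p.2 ^ p.1 := by
  have h : evenTorusSum N = ∑ p ∈ N.divisorsAntidiagonal with Even p.1, ∑ e ∈ p.1.divisors,
      MvPowerSeries.C (primRootSum e) * signedVar (p.2 * e) ^ (p.1 / e) := by
    refine Finset.sum_congr rfl fun p hp => torusSum_eq ?_ _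
    obtain ⟨h1, h2⟩ := Nat.mem_divisorsAntidiagonal.1 (Finset.mem_filter.1 hp).1
    exact Nat.pos_of_ne_zero fun h0 => h2 (by rw [← h1, h0, zero_mul])
  rw [h]
  simp only [map_sum, Finset.sum_mul]
  rw [Finset.sum_sigma', Finset.sum_sigma']
  refine Finset.sum_nbij' (fun s => ⟨(s.1.1 / s.2, s.1.2 * s.2), s.2⟩)
    (fun s => ⟨(s.1.1 * s.2, s.1.2 / s.2), s.2⟩) ?_ ?_ ?_ ?_ ?_
  · rintro ⟨⟨i, k⟩, e⟩ hh
    simp only [Finset.mem_sigma, Finset.mem_filter, Nat.mem_divisorsAntidiagonal,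
      Nat.mem_divisors] at hh ⊢
    obtain ⟨⟨⟨rfl, h0⟩, hev⟩, ⟨d, rfl⟩, hed⟩ := hh
    obtain ⟨he, hd⟩ := mul_ne_zero_iff.1 hed
    obtain ⟨-, hk⟩ := mul_ne_zero_iff.1 h0
    rw [Nat.mul_div_cancel_left _ (Nat.pos_of_ne_zero he)]
    exact ⟨⟨by ring, h0⟩, ⟨dvd_mul_left _ _, mul_ne_zero hk he⟩, by rwa [mul_comm]⟩
  · rintro ⟨⟨d, m⟩, e⟩ hh
    simp only [Finset.mem_sigma, Finset.mem_filter, Nat.mem_divisorsAntidiagonal,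
      Nat.mem_divisors] at hh ⊢
    obtain ⟨⟨rfl, h0⟩, ⟨⟨k, rfl⟩, hek⟩, hev⟩ := hh
    obtain ⟨he, hk⟩ := mul_ne_zero_iff.1 hek
    obtain ⟨hd, -⟩ := mul_ne_zero_iff.1 h0
    rw [Nat.mul_div_cancel_left _ (Nat.pos_of_ne_zero he)]
    exact ⟨⟨⟨by ring, h0⟩, hev⟩, dvd_mul_left _ _, mul_ne_zero hd he⟩
  · rintro ⟨⟨i, k⟩, e⟩ hh
    simp only [Finset.mem_sigma, Finset.mem_filter, Nat.mem_divisorsAntidiagonal,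
      Nat.mem_divisors] at hh
    obtain ⟨-, ⟨d, rfl⟩, hed⟩ := hh
    obtain ⟨he, hd⟩ := mul_ne_zero_iff.1 hed
    simp only
    rw [Nat.mul_div_cancel_left _ (Nat.pos_of_ne_zero he),
      Nat.mul_div_cancel _ (Nat.pos_of_ne_zero he), mul_comm d e]
  · rintro ⟨⟨d, m⟩, e⟩ hh
    simp only [Finset.mem_sigma, Finset.mem_filter, Nat.mem_divisorsAntidiagonal,
      Nat.mem_divisors] at hh
    obtain ⟨-, ⟨⟨k, rfl⟩, hek⟩, -⟩ := hh
    obtain ⟨he, hk⟩ := mul_ne_zero_iff.1 hek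
    simp only
    rw [Nat.mul_div_cancel_left _ (Nat.pos_of_ne_zero he),
      Nat.mul_div_cancel _ (Nat.pos_of_ne_zero he), mul_comm k e]
  · rintro ⟨⟨i, k⟩, e⟩ _; rfl

theorem evenTorusSum_odd {N : ℕ} (hN : Odd N) : evenTorusSum N = 0 := by
  refine Finset.sum_eq_zero fun p hp => ?_
  exfalso
  rw [Finset.mem_filter, Nat.mem_divisorsAntidiagonal] at hp
  obtain ⟨⟨h, -⟩, hev⟩ := hp
  rw [← h, Nat.odd_mul] at hN
  exact absurd hev (Nat.not_even_iff_odd.2 hN.1)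

theorem evenTorusSum_zero : evenTorusSum 0 = 0 := by simp [evenTorusSum]

/-- For even `d` only `m = 1` survives, giving the power of `t_1`. For odd `d` the length `m`
carries the full power of two, and only `m = 2 ^ (p + 1)` with `d = q` survives. Its coefficient
`-1` cancels the sign of an odd number of even cycles. -/
theorem evenTorusSum_even (p : ℕ) {q : ℕ} (hq : Odd q) :
    evenTorusSum (2 ^ (p + 1) * q) = MvPowerSeries.X 1 ^ (2 ^ (p + 1) * q) +
      MvPowerSeries.X (2 ^ (p + 1)) ^ q := by
  set N := 2 ^ (p + 1) * q with hN
  have hpos : N ≠ 0 := mul_ne_zero (by positivity) hq.pos.ne'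
  have hNe : Even N := ⟨2 ^ p * q, by rw [hN]; ring⟩
  rw [evenTorusSum_eq, ← Finset.sum_filter_add_sum_filter_not _ fun s => Even s.1]
  congr 1
  · rw [Finset.sum_eq_single (N, 1)]
    · rw [sum_primRootSum_of_even one_pos hNe, if_pos rfl, map_one, one_mul, signedVar]
      simp
    · rintro ⟨d, m⟩ hs hne
      obtain ⟨hs, hd⟩ := Finset.mem_filter.1 hs
      obtain ⟨h1, -⟩ := Nat.mem_divisorsAntidiagonal.1 hs
      simp only at h1 hd ⊢
      have hm : 0 < m := Nat.pos_of_ne_zero fun h0 => hpos (by rw [← h1, h0, mul_zero])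
      rw [sum_primRootSum_of_even hm hd, if_neg, map_zero, zero_mul]
      rintro rfl
      exact hne (by rw [← h1, mul_one])
    · intro h
      exact absurd (Finset.mem_filter.2
        ⟨Nat.mem_divisorsAntidiagonal.2 ⟨mul_one N, hpos⟩, hNe⟩) h
  · rw [Finset.sum_eq_single (q, 2 ^ (p + 1))]
    · have := sum_primRootSum_of_odd (r := p) hq odd_one
      rw [mul_one] at this
      simp only
      have he : Even (2 ^ (p + 1)) := ⟨2 ^ p, by ring⟩
      rw [this, if_pos rfl, signedVar, he.neg_one_pow, map_neg, map_one, neg_one_mul, neg_one_mul,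
        hq.neg_pow, neg_neg]
    · rintro ⟨d, m⟩ hs hne
      obtain ⟨hs, hd⟩ := Finset.mem_filter.1 hs
      obtain ⟨h1, -⟩ := Nat.mem_divisorsAntidiagonal.1 hs
      simp only [Nat.not_even_iff_odd] at h1 hd ⊢
      have hm : m ≠ 0 := fun h0 => hpos (by rw [← h1, h0, mul_zero])
      obtain ⟨r, s, hs', rfl⟩ := Nat.exists_eq_two_pow_mul_odd hm
      obtain ⟨h2, h3⟩ := two_pow_mul_odd_inj (r := r) (d := d * s) (hd.mul hs') hq
        (by rw [← hN, ← h1]; ring)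
      subst h2
      rw [sum_primRootSum_of_odd hd hs', if_neg, map_zero, zero_mul]
      rintro rfl
      exact hne (by rw [← h3, mul_one, mul_one])
    · intro h
      exact absurd (Finset.mem_filter.2
        ⟨Nat.mem_divisorsAntidiagonal.2 ⟨by rw [hN, mul_comm], hpos⟩,
          Nat.not_even_iff_odd.2 hq⟩) h

end RootSums

/-! ### The Euler derivation and the factors of the product -/

section Euler

/-- The weighted degree in which `t_j` has weight `j` for `j ≥ 1`, and `t_0` has weight `1`. -/
noncomputable def wdeg : (ℕ →₀ ℕ) →+ ℕ := Finsupp.weight fun j => if j = 0 then 1 else j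

theorem wdeg_single {j : ℕ} (hj : j ≠ 0) (k : ℕ) : wdeg (Finsupp.single j k) = k * j := by
  rw [wdeg, Finsupp.weight_single, if_neg hj, smul_eq_mul]

/-- This is why `t_0` receives a positive weight: degree zero must mean the constant coefficient. -/
theorem wdeg_eq_zero {μ : ℕ →₀ ℕ} (h : wdeg μ = 0) : μ = 0 := by
  have : Finsupp.NonTorsionWeight ℕ (fun j : ℕ => if j = 0 then 1 else j) := by
    refine Finsupp.nonTorsionWeight_of (w := fun j : ℕ => if j = 0 then 1 else j) ℕ fun i => ?_
    split_ifs with h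
    · exact one_ne_zero
    · exact h
  exact (Finsupp.weight_eq_zero_iff_eq_zero _).1 h

/-- The Euler derivation, which multiplies each coefficient by its weighted degree. -/
noncomputable def euler : Derivation ℂ (MvPowerSeries ℕ ℂ) (MvPowerSeries ℕ ℂ) :=
  Derivation.mk'
    { toFun := fun f μ => (wdeg μ : ℂ) * MvPowerSeries.coeff μ f
      map_add' := fun f g => by
        ext μ
        change (wdeg μ : ℂ) * MvPowerSeries.coeff μ (f + g) =
          (wdeg μ : ℂ) * MvPowerSeries.coeff μ f + (wdeg μ : ℂ) * MvPowerSeries.coeff μ g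
        rw [map_add, mul_add]
      map_smul' := fun c f => by
        ext μ
        change (wdeg μ : ℂ) * MvPowerSeries.coeff μ (c • f) =
          c * ((wdeg μ : ℂ) * MvPowerSeries.coeff μ f)
        rw [map_smul, smul_eq_mul]; ring }
    (fun f g => by
      ext μ
      rw [map_add, smul_eq_mul, smul_eq_mul, MvPowerSeries.coeff_mul, mul_comm g,
        MvPowerSeries.coeff_mul, ← Finset.sum_add_distrib]
      change (wdeg μ : ℂ) * MvPowerSeries.coeff μ (f * g) = _
      rw [MvPowerSeries.coeff_mul, Finset.mul_sum]
      refine Finset.sum_congr rfl fun p hp => ?_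
      change _ = MvPowerSeries.coeff p.1 f * ((wdeg p.2 : ℂ) * MvPowerSeries.coeff p.2 g) +
        ((wdeg p.1 : ℂ) * MvPowerSeries.coeff p.1 f) * MvPowerSeries.coeff p.2 g
      rw [← Finset.HasAntidiagonal.mem_antidiagonal.1 hp, map_add]
      push_cast
      ring)

theorem coeff_euler (μ : ℕ →₀ ℕ) (f : MvPowerSeries ℕ ℂ) :
    MvPowerSeries.coeff μ (euler f) = (wdeg μ : ℂ) * MvPowerSeries.coeff μ f := rfl

theorem euler_X {j : ℕ} (hj : j ≠ 0) :
    euler (MvPowerSeries.X j) = (j : MvPowerSeries ℕ ℂ) * MvPowerSeries.X j := by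
  classical
  ext μ
  rw [coeff_euler, ← map_natCast (MvPowerSeries.C (σ := ℕ) (R := ℂ)), MvPowerSeries.coeff_C_mul,
    MvPowerSeries.coeff_X]
  split_ifs with h
  · rw [h, wdeg_single hj, one_mul]
  · simp

/-- The sum of the odd powers of `t_m`. -/
noncomputable def oddPowers (m : ℕ) : MvPowerSeries ℕ ℂ :=
  open Classical in fun μ => if ∃ q, Odd q ∧ μ = Finsupp.single m q then 1 else 0

open Classical in
theorem coeff_oddPowers (m : ℕ) (μ : ℕ →₀ ℕ) : MvPowerSeries.coeff μ (oddPowers m) =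
    if ∃ q, Odd q ∧ μ = Finsupp.single m q then 1 else 0 := rfl

/-- The identity `∑ t^q = t / (1 - t^2)` over odd `q`, with the denominator cleared. -/
theorem oddPowers_mul (m : ℕ) :
    oddPowers m * (1 - MvPowerSeries.X m ^ 2) = MvPowerSeries.X m := by
  classical
  ext μ
  rw [mul_sub, mul_one, map_sub, MvPowerSeries.X_pow_eq, MvPowerSeries.coeff_mul_monomial,
    coeff_oddPowers, coeff_oddPowers, MvPowerSeries.coeff_X, mul_one]
  by_cases h1 : ∃ q, Odd q ∧ μ = Finsupp.single m q
  · obtain ⟨q, hq, rfl⟩ := h1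
    rw [if_pos ⟨q, hq, rfl⟩]
    by_cases h2 : q = 1
    · subst h2
      rw [if_neg, if_pos rfl, sub_zero]
      simp
    · have h3 : 2 ≤ q := by
        have := hq.pos
        omega
      rw [if_pos (by simpa using h3), if_pos ⟨q - 2, Nat.Odd.sub_even h3 hq even_two, by simp⟩,
        sub_self, if_neg]
      intro h
      exact h2 (Finsupp.single_injective m h)
  · rw [if_neg h1, if_neg (c := μ = _) fun h => h1 ⟨1, odd_one, h⟩]
    split_ifs with h2 h3
    · obtain ⟨q, hq, h3⟩ := h3
      refine absurd ⟨q + 2, hq.add_even even_two, ?_⟩ h1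
      rw [Finsupp.single_add, ← h3, tsub_add_cancel_of_le h2]
    · simp
    · simp

/-- The `p`-th factor of the product. -/
noncomputable def rootFactor (p : ℕ) : MvPowerSeries ℕ ℂ :=
  fpow ((1 + MvPowerSeries.X (2 ^ p)) * (1 - MvPowerSeries.X (2 ^ p))⁻¹) (1 / 2 ^ (p + 1))

theorem constantCoeff_fpow {f : MvPowerSeries ℕ ℂ} (hf : MvPowerSeries.constantCoeff f = 1)
    (r : ℂ) : MvPowerSeries.constantCoeff (fpow f r) = 1 := by
  have ha : PowerSeries.HasSubst (f - 1) :=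
    PowerSeries.HasSubst.of_constantCoeff_zero (by simp [hf])
  have hB := PowerSeries.eq_X_mul_shift_add_const (PowerSeries.binomialSeries ℂ r)
  rw [fpow, hB, ← PowerSeries.coe_substAlgHom ha, map_add, map_mul, PowerSeries.coe_substAlgHom,
    PowerSeries.subst_X ha, map_add, map_mul, map_sub, hf, map_one, sub_self, zero_mul, zero_add,
    ← PowerSeries.coeff_zero_eq_constantCoeff_apply, PowerSeries.binomialSeries_coeff,
    Ring.choose_zero_right, one_smul, map_one, ← PowerSeries.coe_substAlgHom ha, map_one, map_one]

theorem constantCoeff_ratio (m : ℕ) : MvPowerSeries.constantCoeff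
    ((1 + MvPowerSeries.X m) * (1 - MvPowerSeries.X m)⁻¹ : MvPowerSeries ℕ ℂ) = 1 := by
  simp

theorem constantCoeff_rootFactor (p : ℕ) :
    MvPowerSeries.constantCoeff (rootFactor p) = 1 :=
  constantCoeff_fpow (constantCoeff_ratio _) _

/-- This equation and the constant term `1` are all that is used about the binomial power from here
on. -/
theorem rootFactor_pow (p : ℕ) : rootFactor p ^ 2 ^ (p + 1) * (1 - MvPowerSeries.X (2 ^ p)) =
    1 + MvPowerSeries.X (2 ^ p) := by
  have h := fpow_root _ (constantCoeff_ratio (2 ^ p)) (2 ^ (p + 1)) (by positivity)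
  have hc : ((2 ^ (p + 1) : ℕ) : ℂ) = 2 ^ (p + 1) := by push_cast; rfl
  rw [hc] at h
  rw [rootFactor, h, mul_assoc, MvPowerSeries.inv_mul_cancel _ (by simp), mul_one]

/-- The weight `2^p` of `t` and the exponent `1 / 2^{p+1}` combine to `1/2`, so the logarithmic
derivative is `(t/2) (1/(1+t) + 1/(1-t)) = t / (1 - t^2)`. -/
theorem euler_rootFactor (p : ℕ) : euler (rootFactor p) = oddPowers (2 ^ p) * rootFactor p := by
  have h1 := rootFactor_pow p
  have h2 := congrArg euler h1
  have h3 := oddPowers_mul (2 ^ p)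
  rw [Derivation.leibniz, Derivation.leibniz_pow, map_sub, map_add, Derivation.map_one_eq_zero,
    euler_X (by positivity), smul_eq_mul, smul_eq_mul, nsmul_eq_mul, smul_eq_mul] at h2
  set t : MvPowerSeries ℕ ℂ := MvPowerSeries.X (2 ^ p)
  set g := rootFactor p
  set D := oddPowers (2 ^ p)
  obtain ⟨M, hM⟩ : ∃ M, 2 ^ (p + 1) = M + 1 := Nat.exists_eq_succ_of_ne_zero (by positivity)
  have hcast : ((2 ^ (p + 1) : ℕ) : MvPowerSeries ℕ ℂ) = 2 * ((2 ^ p : ℕ) : MvPowerSeries ℕ ℂ) := by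
    push_cast; ring
  have hk : ((2 ^ p : ℕ) : MvPowerSeries ℕ ℂ) ≠ 0 := by
    intro h0
    have := congrArg MvPowerSeries.constantCoeff h0
    rw [map_natCast, map_zero] at this
    exact absurd this (Nat.cast_ne_zero.2 (by positivity))
  rw [hcast, hM, Nat.add_sub_cancel] at h2
  rw [hM] at h1
  set K := ((2 ^ p : ℕ) : MvPowerSeries ℕ ℂ)
  have ht1 : 1 + t ≠ 0 := by
    intro h0
    have := congrArg MvPowerSeries.constantCoeff h0
    simp [t] at this
  have ht2 : 1 - t ≠ 0 := by
    intro h0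
    have := congrArg MvPowerSeries.constantCoeff h0
    simp [t] at this
  have h22 : (2 : MvPowerSeries ℕ ℂ) ≠ 0 := by
    intro h0
    have := congrArg MvPowerSeries.constantCoeff h0
    rw [map_ofNat, map_zero] at this
    exact two_ne_zero this
  rw [← sub_eq_zero]
  -- The power series ring is a domain, so it suffices to prove the equation after clearing the
  -- nonzero factors.
  have hfin : 2 * K * (1 + t) * (1 - t) * (euler g - D * g) = 0 := by
    linear_combination (g * (1 - t)) * h2 - (2 * K * (1 - t) * euler g - g * K * t) * h1 -
      2 * K * g * h3
  simpa [hk, ht1, ht2, h22] using hfin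

end Euler

/-! ### Comparing coefficients through the logarithmic derivative -/

section Coefficients

/-- The monomial `t_{2^p}^q` for `N = 2^p q` with `q` odd. -/
noncomputable def twoPartMonomial (N : ℕ) : MvPowerSeries ℕ ℂ :=
  if N = 0 then 0 else MvPowerSeries.X (2 ^ N.factorization 2) ^ (N / 2 ^ N.factorization 2)

theorem twoPartMonomial_eq (p : ℕ) {q : ℕ} (hq : Odd q) :
    twoPartMonomial (2 ^ p * q) = MvPowerSeries.X (2 ^ p) ^ q := by
  have hq0 := hq.pos.ne'
  have hf : (2 ^ p * q).factorization 2 = p := by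
    rw [Nat.factorization_mul (by positivity) hq0, Finsupp.add_apply,
      Nat.factorization_pow_self Nat.prime_two,
      Nat.factorization_eq_zero_of_not_dvd hq.not_two_dvd_nat, add_zero]
  rw [twoPartMonomial, if_neg (mul_ne_zero (by positivity) hq0), hf,
    Nat.mul_div_cancel_left _ (by positivity)]

theorem coeff_twoPartMonomial_eq_zero {μ : ℕ →₀ ℕ} {N : ℕ} (h : wdeg μ ≠ N) :
    MvPowerSeries.coeff μ (twoPartMonomial N) = 0 := by
  classical
  by_cases h0 : N = 0
  · rw [twoPartMonomial, if_pos h0, map_zero]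
  · obtain ⟨p, q, hq, rfl⟩ := Nat.exists_eq_two_pow_mul_odd h0
    rw [twoPartMonomial_eq p hq, MvPowerSeries.coeff_X_pow, if_neg]
    rintro rfl
    exact h (by rw [wdeg_single (by positivity), mul_comm])

/-- By unique factorization `N = 2^p q` with `q` odd, exactly one monomial of each degree `N ≥ 1`
occurs among the odd powers of all `t_{2^p}`. Factors with `2^p > N` play no role. -/
theorem sum_coeff_oddPowers (s : Finset ℕ) {μ : ℕ →₀ ℕ} (hs : ∀ p, 2 ^ p ≤ wdeg μ → p ∈ s) :
    ∑ p ∈ s, MvPowerSeries.coeff μ (oddPowers (2 ^ p)) =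
      MvPowerSeries.coeff μ (twoPartMonomial (wdeg μ)) := by
  classical
  by_cases h0 : wdeg μ = 0
  · rw [twoPartMonomial, if_pos h0, map_zero]
    refine Finset.sum_eq_zero fun p _ => ?_
    rw [coeff_oddPowers, if_neg]
    rintro ⟨q, hq, rfl⟩
    rw [wdeg_single (by positivity)] at h0
    exact mul_ne_zero hq.pos.ne' (by positivity) h0
  · obtain ⟨p, q, hq, hN⟩ := Nat.exists_eq_two_pow_mul_odd h0
    have hp : p ∈ s := hs p (by rw [hN]; exact Nat.le_mul_of_pos_right _ hq.pos)
    rw [hN, twoPartMonomial_eq p hq, MvPowerSeries.coeff_X_pow]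
    have key : ∀ p' q', Odd q' → μ = Finsupp.single (2 ^ p') q' → p' = p ∧ q' = q := by
      rintro p' q' hq' rfl
      rw [wdeg_single (by positivity), mul_comm] at hN
      exact two_pow_mul_odd_inj hq' hq hN
    rw [Finset.sum_eq_single p]
    · rw [coeff_oddPowers]
      refine if_congr ⟨?_, fun h => ⟨q, hq, h⟩⟩ rfl rfl
      rintro ⟨q', hq', h⟩
      rw [h, (key p q' hq' h).2]
    · intro p' _ hne
      rw [coeff_oddPowers, if_neg]
      rintro ⟨q', hq', h⟩
      exact hne (key p' q' hq' h).1
    · exact fun h => absurd hp h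

theorem euler_prod_rootFactor (s : Finset ℕ) :
    euler (∏ p ∈ s, rootFactor p) =
      (∑ p ∈ s, oddPowers (2 ^ p)) * ∏ p ∈ s, rootFactor p := by
  classical
  induction s using Finset.induction_on with
  | empty => simp
  | insert p s hp ih =>
    rw [Finset.prod_insert hp, Finset.sum_insert hp, Derivation.leibniz, ih, euler_rootFactor,
      smul_eq_mul, smul_eq_mul]
    ring

/-- A sequence satisfying the recursion of the logarithmic derivative of the product has the
coefficients of the product. -/
theorem coeff_eq_coeff_prod {S : ℕ → MvPowerSeries ℕ ℂ} (h0 : S 0 = 1)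
    (h : ∀ n : ℕ, (n : MvPowerSeries ℕ ℂ) * S n =
      ∑ p ∈ Finset.HasAntidiagonal.antidiagonal n, twoPartMonomial p.1 * S p.2)
    (s : Finset ℕ) (n : ℕ) (μ : ℕ →₀ ℕ) (hμ : wdeg μ = n) (hs : ∀ p, 2 ^ p ≤ n → p ∈ s) :
    MvPowerSeries.coeff μ (S n) = MvPowerSeries.coeff μ (∏ p ∈ s, rootFactor p) := by
  classical
  induction n using Nat.strong_induction_on generalizing μ with
  | _ n ih =>
  by_cases hn : n = 0
  · subst hn
    rw [wdeg_eq_zero hμ, h0, MvPowerSeries.coeff_zero_eq_constantCoeff_apply,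
      MvPowerSeries.coeff_zero_eq_constantCoeff_apply, map_one, map_prod]
    simp [constantCoeff_rootFactor]
  · have hn' : (n : ℂ) ≠ 0 := Nat.cast_ne_zero.2 hn
    refine mul_left_cancel₀ hn' ?_
    have h1 := congrArg (MvPowerSeries.coeff μ) (h n)
    rw [← map_natCast (MvPowerSeries.C (σ := ℕ) (R := ℂ)), MvPowerSeries.coeff_C_mul,
      map_sum] at h1
    have h2 := congrArg (MvPowerSeries.coeff μ) (euler_prod_rootFactor s)
    rw [coeff_euler, hμ] at h2
    rw [h1, h2, MvPowerSeries.coeff_mul]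
    simp_rw [MvPowerSeries.coeff_mul]
    rw [Finset.sum_comm]
    refine Finset.sum_congr rfl fun x hx => ?_
    have hx' : wdeg x.1 + wdeg x.2 = n := by
      rw [← map_add, Finset.HasAntidiagonal.mem_antidiagonal.1 hx, hμ]
    rw [map_sum, sum_coeff_oddPowers s fun p hp => hs p (by omega),
      Finset.sum_eq_single (wdeg x.1, wdeg x.2)]
    -- The degree zero term vanishes, so the induction hypothesis is needed only in degrees below
    -- `n`.
    · by_cases hx0 : wdeg x.1 = 0
      · simp [hx0, twoPartMonomial]
      · rw [ih (wdeg x.2) (by omega) x.2 rfl fun p hp => hs p (by omega)]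
    · rintro ⟨k, l⟩ hkl hne
      rw [Finset.HasAntidiagonal.mem_antidiagonal] at hkl
      simp only at hkl ⊢
      rw [coeff_twoPartMonomial_eq_zero, zero_mul]
      rintro rfl
      exact hne (Prod.ext rfl (by simp only; omega))
    · exact fun hh => absurd (Finset.HasAntidiagonal.mem_antidiagonal.2 hx') hh

end Coefficients

/-! ### Recursion for the cycle types in `EP` -/

section Recursion

variable {ζ : ℕ → ℂ}

-- The recursion is a first-order equation for the generating function in an auxiliary variable `X`
-- marking `n`. Logarithmic derivatives add, so the factor `1 + t_1 X` adds its own to that of the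
-- even series.
open PowerSeries in
theorem natCast_mul_epSeries (hζ : ∀ i : ℕ, 0 < i → IsPrimitiveRoot (ζ i) i) (n : ℕ) :
    (n : MvPowerSeries ℕ ℂ) * epSeries ζ n =
      ∑ p ∈ Finset.HasAntidiagonal.antidiagonal n, twoPartMonomial p.1 * epSeries ζ p.2 := by
  set t : MvPowerSeries ℕ ℂ := MvPowerSeries.X 1 with ht
  set A : PowerSeries (MvPowerSeries ℕ ℂ) := PowerSeries.mk (evenSeries ζ) with hA
  set c : PowerSeries (MvPowerSeries ℕ ℂ) := PowerSeries.mk evenTorusSum with hc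
  set S : PowerSeries (MvPowerSeries ℕ ℂ) := PowerSeries.mk (epSeries ζ) with hS
  set D : PowerSeries (MvPowerSeries ℕ ℂ) := PowerSeries.mk twoPartMonomial with hD
  -- `U` is the expansion of `tX / (1 + tX)`, the logarithmic derivative of `1 + tX` under `X d/dX`.
  set U : PowerSeries (MvPowerSeries ℕ ℂ) :=
    PowerSeries.mk fun k => if k = 0 then 0 else -(-t) ^ k with hU
  have coeff_Xd : ∀ (f : PowerSeries (MvPowerSeries ℕ ℂ)) (m : ℕ),
      PowerSeries.coeff m (PowerSeries.X * PowerSeries.derivative (MvPowerSeries ℕ ℂ) f) =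
        m * PowerSeries.coeff m f := by
    intro f m
    cases m with
    | zero => simp
    | succ m =>
      rw [PowerSeries.coeff_succ_X_mul, PowerSeries.coeff_derivative]
      push_cast
      ring
  have h1 : PowerSeries.X * PowerSeries.derivative (MvPowerSeries ℕ ℂ) A = c * A := by
    ext1 m
    rw [coeff_Xd, PowerSeries.coeff_mul, hA, hc]
    simp only [PowerSeries.coeff_mk]
    exact natCast_mul_evenSeries hζ m
  have h2 : S = (1 + PowerSeries.C t * PowerSeries.X) * A := by
    ext1 m
    rw [add_mul, one_mul, map_add, mul_assoc, PowerSeries.coeff_C_mul, hS, hA]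
    cases m with
    | zero => simp [epSeries_zero hζ, evenSeries_zero]
    | succ m =>
      rw [PowerSeries.coeff_succ_X_mul]
      simp only [PowerSeries.coeff_mk]
      exact epSeries_succ hζ m
  have h3 : U * (1 + PowerSeries.C t * PowerSeries.X) = PowerSeries.C t * PowerSeries.X := by
    ext1 m
    rw [mul_add, mul_one, map_add, mul_left_comm, PowerSeries.coeff_C_mul, PowerSeries.coeff_C_mul,
      hU]
    rcases m with _ | _ | m
    · simp
    · simp
    · rw [PowerSeries.coeff_succ_mul_X, PowerSeries.coeff_X, if_neg (by omega)]
      simp only [PowerSeries.coeff_mk]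
      rw [if_neg (by omega), if_neg (by omega)]
      ring
  -- In even degree, `U` cancels the power of `t_1` in the torus sum; in odd degree the torus sum is
  -- zero and `U` supplies that power.
  have h4 : D = c + U := by
    ext1 m
    rw [map_add, hD, hc, hU]
    simp only [PowerSeries.coeff_mk]
    by_cases hm : m = 0
    · subst hm
      simp [twoPartMonomial, evenTorusSum_zero]
    · rw [if_neg hm]
      obtain ⟨p, q, hq, rfl⟩ := Nat.exists_eq_two_pow_mul_odd hm
      rw [twoPartMonomial_eq p hq]
      cases p with
      | zero =>
        rw [pow_zero, one_mul, evenTorusSum_odd hq, hq.neg_pow, neg_neg, zero_add]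
      | succ p =>
        have he : Even (2 ^ (p + 1) * q) := ⟨2 ^ p * q, by ring⟩
        rw [evenTorusSum_even p hq, he.neg_pow]
        ring
  have h5 : PowerSeries.X * PowerSeries.derivative (MvPowerSeries ℕ ℂ) S = D * S := by
    have hd : PowerSeries.derivative (MvPowerSeries ℕ ℂ)
        (1 + PowerSeries.C t * PowerSeries.X) = PowerSeries.C t := by
      rw [map_add, Derivation.map_one_eq_zero, zero_add, Derivation.leibniz,
        PowerSeries.derivative_X, PowerSeries.derivative_C]
      simp
    rw [h2, Derivation.leibniz, hd, h4, smul_eq_mul, smul_eq_mul]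
    linear_combination (1 + PowerSeries.C t * PowerSeries.X) * h1 - A * h3
  have h6 := congrArg (PowerSeries.coeff n) h5
  rw [coeff_Xd, PowerSeries.coeff_mul, hS, hD] at h6
  simpa only [PowerSeries.coeff_mk] using h6

end Recursion

/-! ### Sums over partitions as averages over the symmetric group -/

section ClassFunctions

variable {n : ℕ}

/-- The cycle type of a permutation of `Fin n`, as a partition of `n`. -/
noncomputable def cyclePartition (x : Perm (Fin n)) : n.Partition where
  parts := x.partition.parts
  parts_pos := x.partition.parts_pos
  parts_sum := x.partition.parts_sum.trans (Fintype.card_fin n)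

theorem isConj_permOf_iff {lam : n.Partition} {x : Perm (Fin n)} :
    IsConj (permOf lam) x ↔ cyclePartition x = lam := by
  rw [Perm.partition_eq_of_isConj, Nat.Partition.ext_iff, Nat.Partition.ext_iff, permOf_spec]
  exact eq_comm

theorem card_isConj_mul_cardZ (lam : n.Partition) :
    Nat.card {x | IsConj (permOf lam) x} * cardZ lam = n.factorial := by
  rw [cardZ, Perm.nat_card_centralizer, Perm.card_isConj_mul_eq (permOf lam), Fintype.card_fin]

/-- The average of a class function is the sum of its values on the conjugacy classes, divided by
the orders of the centralizers. -/
theorem sum_permOf_eq_sum_perm (F : Perm (Fin n) → MvPowerSeries ℕ ℂ)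
    (hF : ∀ x y, F (y * x * y⁻¹) = F x) :
    ∑ lam : n.Partition, MvPowerSeries.C ((cardZ lam : ℂ)⁻¹) * F (permOf lam) =
      MvPowerSeries.C ((n.factorial : ℂ)⁻¹) * ∑ x, F x := by
  classical
  rw [← Finset.sum_fiberwise (s := Finset.univ) (g := cyclePartition) (f := F), Finset.mul_sum]
  refine Finset.sum_congr rfl fun lam _ => ?_
  have h1 : ∀ x ∈ Finset.univ.filter (fun x : Perm (Fin n) => cyclePartition x = lam),
      F x = F (permOf lam) := by
    intro x hx
    obtain ⟨y, rfl⟩ := isConj_iff.1 (isConj_permOf_iff.2 (Finset.mem_filter.1 hx).2)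
    exact hF _ _
  rw [Finset.sum_congr rfl h1, Finset.sum_const, nsmul_eq_mul, ← mul_assoc,
    ← map_natCast (MvPowerSeries.C (σ := ℕ) (R := ℂ)), ← map_mul]
  congr 2
  have h2 := card_isConj_mul_cardZ lam
  have h3 : Nat.card {x | IsConj (permOf lam) x} =
      (Finset.univ.filter (fun x : Perm (Fin n) => cyclePartition x = lam)).card := by
    rw [← Fintype.card_subtype, ← Nat.card_eq_fintype_card]
    exact Nat.card_congr (Equiv.subtypeEquivRight fun x => isConj_permOf_iff)
  rw [h3] at h2
  have h4 : cardZ lam ≠ 0 := fun h0 => n.factorial_ne_zero (by rw [← h2, h0, mul_zero])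
  have h5 : (n.factorial : ℂ) ≠ 0 := Nat.cast_ne_zero.2 n.factorial_ne_zero
  have h6 : (cardZ lam : ℂ) ≠ 0 := Nat.cast_ne_zero.2 h4
  rw [inv_eq_iff_eq_inv, mul_inv, inv_inv, eq_mul_inv_iff_mul_eq₀, ← h2]
  · push_cast; ring
  · intro h0
    rw [Nat.cast_eq_zero] at h0
    rw [h0, zero_mul] at h2
    exact n.factorial_ne_zero h2.symm

end ClassFunctions

/-! ### From higher Lie characters to commuting pairs -/

section Characters

variable {n : ℕ} {ζ : ℕ → ℂ}

theorem cycleMonomial_conj {α : Type*} [Fintype α] [DecidableEq α] (z y : Perm α) :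
    cycleMonomial (y * z * y⁻¹) = cycleMonomial z := by
  rw [← cycleMonomial_permCongr y z]
  congr 1

-- Frobenius reciprocity: conjugating the summation variable makes every term of the induced
-- character contribute the same sum over the centralizer, because `cycleMonomial` is a class
-- function.
open Classical in
theorem sum_psiPerm {α : Type*} [Fintype α] [DecidableEq α] (x : Perm α) :
    MvPowerSeries.C (((Fintype.card α).factorial : ℂ)⁻¹) *
      ∑ g, MvPowerSeries.C (psiPerm ζ x g) * cycleMonomial g =
    MvPowerSeries.C ((Nat.card (Subgroup.centralizer {x}) : ℂ)⁻¹) *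
      ∑ z, if z * x = x * z then pairWeight ζ x z else 0 := by
  have h1 : ∀ a : Perm α, ∑ g, MvPowerSeries.C
      (extendZero (Subgroup.centralizer {x}) (omega ζ x) (a⁻¹ * g * a)) * cycleMonomial g =
      ∑ z, if z * x = x * z then pairWeight ζ x z else 0 := by
    intro a
    refine Fintype.sum_equiv (MulAut.conj a⁻¹).toEquiv _ _ fun g => ?_
    have e : (MulAut.conj a⁻¹).toEquiv g = a⁻¹ * g * a := by simp
    rw [e]
    have h2 : cycleMonomial g = cycleMonomial (a⁻¹ * g * a) := by
      conv_rhs => rw [← cycleMonomial_conj _ a]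
      congr 1; group
    rw [h2]
    generalize a⁻¹ * g * a = z
    unfold extendZero
    by_cases hz : z * x = x * z
    · rw [dif_pos (Subgroup.mem_centralizer_singleton_iff.2 hz), if_pos hz]; rfl
    · rw [dif_neg fun h => hz (Subgroup.mem_centralizer_singleton_iff.1 h), if_neg hz, map_zero,
        zero_mul]
  have h3 : ∑ g, MvPowerSeries.C (psiPerm ζ x g) * cycleMonomial g =
      MvPowerSeries.C ((Nat.card (Subgroup.centralizer {x}) : ℂ)⁻¹) *
      (((Fintype.card α).factorial : MvPowerSeries ℕ ℂ) * ∑ z, if z * x = x * z then pairWeight ζ x z else 0) := by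
    have h4 := Finset.sum_congr rfl fun (a : Perm α) (_ : a ∈ Finset.univ) => h1 a
    rw [Finset.sum_const, Finset.card_univ, Fintype.card_perm, nsmul_eq_mul] at h4
    rw [← h4, Finset.sum_comm, Finset.mul_sum]
    refine Finset.sum_congr rfl fun g _ => ?_
    rw [psiPerm, induced, map_mul, map_sum, mul_assoc, Finset.sum_mul]
  rw [h3, mul_left_comm, ← mul_assoc (MvPowerSeries.C (((Fintype.card α).factorial : ℂ)⁻¹)),
    ← map_natCast (MvPowerSeries.C (σ := ℕ) (R := ℂ)), ← map_mul, inv_mul_cancel₀, map_one, one_mul]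
  exact Nat.cast_ne_zero.2 (Nat.factorial_ne_zero _)

theorem allEven_iff_parts {α : Type*} [Fintype α] [DecidableEq α] {x : Perm α} :
    AllEven x ↔ ∀ i ∈ x.partition.parts, Even i := by
  constructor
  · intro h i hi
    obtain ⟨a, rfl⟩ := (mem_parts_partition_iff x i).1 hi
    exact h a
  · exact fun h a => h _ ((mem_parts_partition_iff x _).2 ⟨a, rfl⟩)

theorem oneFixed_iff_parts {α : Type*} [Fintype α] [DecidableEq α] {x : Perm α} :
    OneFixed x ↔ x.partition.parts.count 1 = 1 ∧ ∀ i ∈ x.partition.parts, i ≠ 1 → Even i := by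
  have h1 : ∀ a, Function.minimalPeriod x a = 1 ↔ x a = a :=
    fun a => Function.minimalPeriod_eq_one_iff_isFixedPt
  rw [count_one_parts_partition, Finset.card_eq_one]
  constructor
  · rintro ⟨p, hp, he⟩
    refine ⟨⟨p, ?_⟩, ?_⟩
    · ext a
      simp only [Finset.mem_filter, Finset.mem_univ, true_and, Finset.mem_singleton]
      exact ⟨eq_of_apply_eq_of_even he, by rintro rfl; exact hp⟩
    · intro i hi hne
      obtain ⟨a, rfl⟩ := (mem_parts_partition_iff x i).1 hi
      exact he a (by rintro rfl; exact hne ((h1 _).2 hp))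
  · rintro ⟨⟨p, hp⟩, he⟩
    have hfix : ∀ a, x a = a ↔ a = p := fun a => by
      have := Finset.ext_iff.1 hp a
      simpa using this
    refine ⟨p, (hfix p).2 rfl, fun a ha => he _ ((mem_parts_partition_iff x _).2 ⟨a, rfl⟩) ?_⟩
    rw [Ne, h1, hfix]
    exact ha

/-- The parity of `n` required by `EP` follows from the parts, whose sum is `n`. -/
theorem mem_EP_iff (lam : n.Partition) : lam ∈ EP n ↔ AllEvenButOne (permOf lam) := by
  rw [AllEvenButOne, allEven_iff_parts, oneFixed_iff_parts, permOf_spec, EP, Finset.mem_filter]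
  simp only [Finset.mem_univ, true_and]
  refine or_congr ⟨fun h => h.2, fun h => ⟨?_, h⟩⟩ ⟨fun h => h.2, fun h => ⟨?_, h⟩⟩
  · rw [← lam.parts_sum]
    exact even_iff_two_dvd.2 (Multiset.dvd_sum fun i hi => even_iff_two_dvd.1 (h i hi))
  · obtain ⟨h1, h2⟩ := h
    have hmem : 1 ∈ lam.parts := Multiset.count_pos.1 (by omega)
    rw [← lam.parts_sum, ← Multiset.cons_erase hmem, Multiset.sum_cons, add_comm]
    refine Even.add_one (even_iff_two_dvd.2 (Multiset.dvd_sum fun i hi => ?_))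
    refine even_iff_two_dvd.1 (h2 i (Multiset.mem_of_mem_erase hi) ?_)
    rintro rfl
    have := Multiset.count_pos.2 hi
    rw [Multiset.count_erase_self] at this
    omega

theorem cycleTerm_psi (lam nu : n.Partition) :
    cycleTerm nu (((signOf nu : ℤ) : ℂ) * psi ζ lam nu / (cardZ nu : ℂ)) =
      MvPowerSeries.C ((cardZ nu : ℂ)⁻¹) *
        (MvPowerSeries.C (psiPerm ζ (permOf lam) (permOf nu)) * cycleMonomial (permOf nu)) := by
  rw [cycleTerm, cycleMonomial_eq_monomial, permOf_spec, ← mul_assoc, ← map_mul,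
    monomial_toFinsupp, monomial_toFinsupp, ← mul_assoc, ← map_mul, psi, signOf, div_eq_mul_inv]
  congr 2
  ring

open Classical in
theorem sum_cycleTerm_psi (lam : n.Partition) :
    ∑ nu : n.Partition, cycleTerm nu (((signOf nu : ℤ) : ℂ) * psi ζ lam nu / (cardZ nu : ℂ)) =
      MvPowerSeries.C ((cardZ lam : ℂ)⁻¹) *
        ∑ z, if z * permOf lam = permOf lam * z then pairWeight ζ (permOf lam) z else 0 := by
  simp_rw [cycleTerm_psi]
  rw [sum_permOf_eq_sum_perm
    (fun g => MvPowerSeries.C (psiPerm ζ (permOf lam) g) * cycleMonomial g)]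
  · have := sum_psiPerm (ζ := ζ) (permOf lam)
    rw [Fintype.card_fin] at this
    exact this
  · intro g y
    rw [cycleMonomial_conj]
    congr 2
    exact induced_conj _ _ _ _

/-- Reciprocity leaves the weight `1/|Z_λ|` on each `λ`, which is exactly the weight that turns a
sum over types into an average over all `x`. This needs the inner sum to be a class function of `x`,
shown by conjugating `x` and `z` simultaneously. -/
theorem sum_EP_eq_epSeries (hζ : ∀ i : ℕ, 0 < i → IsPrimitiveRoot (ζ i) i) (n : ℕ) :
    ∑ lam ∈ EP n, ∑ nu : n.Partition,
      cycleTerm nu (((signOf nu : ℤ) : ℂ) * psi ζ lam nu / (cardZ nu : ℂ)) = epSeries ζ n := by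
  classical
  have hEP : EP n = Finset.univ.filter fun lam => AllEvenButOne (permOf lam) := by
    ext lam; simp [mem_EP_iff]
  have hperm : ∀ (x y : Perm (Fin n)), y * x * y⁻¹ = y.permCongr x := fun x y => rfl
  have h := sum_permOf_eq_sum_perm (n := n) (fun x => if AllEvenButOne x then
    ∑ z, if z * x = x * z then pairWeight ζ x z else 0 else 0) (by
    intro x y
    have hper : ∀ a, Function.minimalPeriod (y * x * y⁻¹) (y a) = Function.minimalPeriod x a :=
      period_conj y x
    have h1 : AllEvenButOne (y * x * y⁻¹) ↔ AllEvenButOne x := by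
      unfold AllEvenButOne
      rw [allEven_iff_parts, allEven_iff_parts, oneFixed_iff_parts, oneFixed_iff_parts, hperm,
        parts_partition_permCongr]
    refine if_congr h1 ?_ rfl
    symm
    refine Fintype.sum_equiv (MulAut.conj y).toEquiv _ _ fun z => ?_
    have hz : (MulAut.conj y).toEquiv z = y * z * y⁻¹ := rfl
    have h2 : z * x = x * z ↔
        y * z * y⁻¹ * (y * x * y⁻¹) = y * x * y⁻¹ * (y * z * y⁻¹) := by
      rw [← (MulAut.conj y).injective.eq_iff, map_mul, map_mul]; rfl
    rw [hz]
    refine if_ctx_congr h2 (fun hh => ?_) fun _ => rfl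
    rw [pairWeight, pairWeight, cycleMonomial_conj, hperm, hperm,
      cycleCharacter_permCongr hζ y (h2.2 hh)])
  have h2 : pairSum ζ (AllEvenButOne (α := Fin n)) = ∑ x : Perm (Fin n), if AllEvenButOne x then
      ∑ z, if z * x = x * z then pairWeight ζ x z else 0 else 0 := by
    refine Finset.sum_congr rfl fun x _ => ?_
    by_cases hx : AllEvenButOne x
    · rw [if_pos hx]
      exact Finset.sum_congr rfl fun z _ =>
        if_ctx_congr (by simp [hx]) (fun _ => rfl) fun _ => rfl
    · rw [if_neg hx]
      exact Finset.sum_eq_zero fun z _ => if_neg fun hh => hx hh.1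
  rw [epSeries, h2, ← h, hEP, Finset.sum_filter]
  refine Finset.sum_congr rfl fun lam _ => ?_
  split_ifs with hl
  · exact sum_cycleTerm_psi lam
  · rw [mul_zero]

theorem wdeg_toFinsupp {s : Multiset ℕ} (h : ∀ i ∈ s, i ≠ 0) :
    wdeg (Multiset.toFinsupp s) = s.sum := by
  induction s using Multiset.induction_on with
  | empty => simp
  | cons a s ih =>
    rw [← Multiset.singleton_add, map_add, map_add, Multiset.toFinsupp_singleton,
      wdeg_single (h a (Multiset.mem_cons_self a s)),
      ih fun i hi => h i (Multiset.mem_cons_of_mem hi), one_mul, Multiset.sum_add,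
      Multiset.sum_singleton]

/-- In the form indexed by partitions `ν` of `n`, every monomial `t^{c(ν)}` visibly has degree `n`.
-/
theorem coeff_epSeries_eq_zero (hζ : ∀ i : ℕ, 0 < i → IsPrimitiveRoot (ζ i) i) {n : ℕ}
    {μ : ℕ →₀ ℕ} (h : wdeg μ ≠ n) : MvPowerSeries.coeff μ (epSeries ζ n) = 0 := by
  rw [← sum_EP_eq_epSeries hζ, map_sum]
  refine Finset.sum_eq_zero fun lam _ => ?_
  rw [map_sum]
  refine Finset.sum_eq_zero fun nu _ => ?_
  rw [cycleTerm, MvPowerSeries.coeff_monomial_ne]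
  rintro rfl
  exact h ((wdeg_toFinsupp fun i hi => (nu.parts_pos hi).ne').trans nu.parts_sum)

end Characters

/-! ### Formal convergence of the sum and the product -/

section Topology

open Filter

theorem formalHasSum_of_eventually {ι : Type*} {f : ι → MvPowerSeries ℕ ℂ}
    {F : MvPowerSeries ℕ ℂ} (h : ∀ μ, ∀ᶠ s : Finset ι in atTop,
      MvPowerSeries.coeff μ (∑ i ∈ s, f i) = MvPowerSeries.coeff μ F) : FormalHasSum f F := by
  unfold FormalHasSum HasSum
  rw [SummationFilter.unconditional_filter]
  -- Formal convergence refers to the discrete topology on `ℂ`, which must replace the usual one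
  -- here.
  let : TopologicalSpace ℂ := ⊥
  refine (MvPowerSeries.WithPiTopology.tendsto_iff_coeff_tendsto _ _ _).2 fun μ => ?_
  exact tendsto_const_nhds.congr' ((h μ).mono fun s hs => hs.symm)

theorem formalHasProd_of_eventually {ι : Type*} {f : ι → MvPowerSeries ℕ ℂ}
    {F : MvPowerSeries ℕ ℂ} (h : ∀ μ, ∀ᶠ s : Finset ι in atTop,
      MvPowerSeries.coeff μ (∏ i ∈ s, f i) = MvPowerSeries.coeff μ F) : FormalHasProd f F := by
  unfold FormalHasProd HasProd
  rw [SummationFilter.unconditional_filter]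
  let : TopologicalSpace ℂ := ⊥
  refine (MvPowerSeries.WithPiTopology.tendsto_iff_coeff_tendsto _ _ _).2 fun μ => ?_
  exact tendsto_const_nhds.congr' ((h μ).mono fun s hs => hs.symm)

/-- The sum of a sequence of power series, of which the `n`-th is homogeneous of degree `n`. -/
noncomputable def gradedSum (S : ℕ → MvPowerSeries ℕ ℂ) : MvPowerSeries ℕ ℂ :=
  fun μ => MvPowerSeries.coeff μ (S (wdeg μ))

theorem coeff_gradedSum (S : ℕ → MvPowerSeries ℕ ℂ) (μ : ℕ →₀ ℕ) :
    MvPowerSeries.coeff μ (gradedSum S) = MvPowerSeries.coeff μ (S (wdeg μ)) := rfl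

theorem formalHasSum_epSeries {ζ : ℕ → ℂ} (hζ : ∀ i : ℕ, 0 < i → IsPrimitiveRoot (ζ i) i) :
    FormalHasSum (epSeries ζ) (gradedSum (epSeries ζ)) := by
  refine formalHasSum_of_eventually fun μ => ?_
  filter_upwards [eventually_ge_atTop {wdeg μ}] with s hs
  rw [map_sum, Finset.sum_eq_single (wdeg μ), coeff_gradedSum]
  · exact fun n _ hn => coeff_epSeries_eq_zero hζ hn.symm
  · exact fun h => absurd (hs (Finset.mem_singleton_self _)) h

theorem formalHasProd_rootFactor {ζ : ℕ → ℂ} (hζ : ∀ i : ℕ, 0 < i → IsPrimitiveRoot (ζ i) i) :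
    FormalHasProd rootFactor (gradedSum (epSeries ζ)) := by
  refine formalHasProd_of_eventually fun μ => ?_
  -- `2 ^ p ≤ wdeg μ` forces `p < wdeg μ`, so this range contains every relevant factor.
  filter_upwards [eventually_ge_atTop (Finset.range (wdeg μ))] with s hs
  rw [coeff_gradedSum]
  exact (coeff_eq_coeff_prod (epSeries_zero hζ) (natCast_mul_epSeries hζ) s _ μ rfl fun p hp =>
    hs (Finset.mem_range.2 (Nat.lt_two_pow_self.trans_le hp))).symm

end Topology

end HigherLie

open HigherLie in
theorem theorem1p4 (ζ : ℕ → ℂ) (hζ : ∀ i : ℕ, 0 < i → IsPrimitiveRoot (ζ i) i) :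
    ∃ F : MvPowerSeries ℕ ℂ,
      FormalHasSum
        (fun n : ℕ => ∑ lam ∈ EP n, ∑ nu : n.Partition,
          cycleTerm nu (((signOf nu : ℤ) : ℂ) * psi ζ lam nu / (cardZ nu : ℂ))) F ∧
      FormalHasProd
        (fun p : ℕ => fpow
          ((1 + MvPowerSeries.X (2 ^ p)) * (1 - MvPowerSeries.X (2 ^ p))⁻¹)
          (1 / 2 ^ (p + 1))) F := by
  -- The common limit is assembled degree by degree from the homogeneous parts.
  refine ⟨gradedSum (epSeries ζ), ?_, formalHasProd_rootFactor hζ⟩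
  simp_rw [sum_EP_eq_epSeries hζ]
  exact formalHasSum_epSeries hζ
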